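/- For a finite $r$-uniform hypergraph ($r$-graph) $G$ with vertex set $V$ and edge set $E\subseteq V^{(r)}$, where $V^{(r)}$ is the family of $r$-subsets of $V$, the Lagrangian of $G$ is $$\lambda(G)=\max\Big\{\sum_{e\in E}\prod_{i\in e}x_i \;:\; x\in\mathbb{R}^V,\ x_i\ge 0 \text{ for all } i\in V,\ \sum_{i\in V}x_i=1\Big\}$$ (with $\lambda(G)=0$ if $V=\emptyset$). On the $r$-subsets of the set $\mathbb{N}$ of positive integers, the colex ordering is given by $A<B$ if and only if $A\ne B$ and $\max(A\triangle B)\in B$. Let $C_{r,m}$ be the $r$-graph whose edges are the first $m$ sets of $\mathbb{N}^{(r)}$ in the colex ordering, and let $[s]^{(r)}$ be the complete $r$-graph on $[s]=\{1,\dots,s\}$. **Corollary.** Let $m,t\ge 0$ be integers (with $\binom{a}{b}=0$ for $a<b$) satisfying $$\binom{t-1}{3}\le m\le\binom{t-1}{3}+\binom{t-2}{2}-\frac12(t-1).$$ Then the Frankl–Füredi conjecture holds for $r=3$ and this value of $m$: the 3-graph $C_{3,m}$ has $m$ edges, and $\lambda(G)\le\lambda(C_{3,m})$ for every 3-graph $G$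 with $m$ edges. In particular, if $m=\binom{s}{3}$ for an integer $s\ge 0$, then $[s]^{(3)}$ has the largest Lagrangian among all 3-graphs with $m$ edges. -/

import Mathlib

/-- A finite `r`-uniform hypergraph (`r`-graph) whose vertices are taken from a type `α`. -/
structure RGraph (r : ℕ) (α : Type*) where
  /-- the vertex set -/
  verts : Finset α
  /-- the edge set -/
  edges : Finset (Finset α)
  /-- every edge is an `r`-subset of the vertex set -/
  edges_subset : edges ⊆ verts.powersetCard r

namespace RGraph

variable {r : ℕ} {α : Type*}

/-- The polynomial `λ(G, x)`: the sum over the edges of the product of the weights. -/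
def lagrangianPoly (G : RGraph r α) (x : α → ℝ) : ℝ := ∑ e ∈ G.edges, ∏ i ∈ e, x i

/-- `x` is a feasible weighting for `G`: its restriction to the vertex set of `G` lies in the
standard simplex. -/
def IsFeasible (G : RGraph r α) (x : α → ℝ) : Prop :=
  (∀ i ∈ G.verts, 0 ≤ x i) ∧ ∑ i ∈ G.verts, x i = 1

/-- The Lagrangian `λ(G)`, the maximum of `λ(G, x)` over the standard simplex. The maximum is
attained as soon as `G` has a vertex (`isGreatest_lagrangian`); for the graph without vertices
the value is `0`. -/
noncomputable def lagrangian (G : RGraph r α) : ℝ :=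
  sSup {y : ℝ | ∃ x : α → ℝ, G.IsFeasible x ∧ G.lagrangianPoly x = y}

theorem isGreatest_lagrangian (G : RGraph r α) (hG : G.verts.Nonempty) :
    IsGreatest {y : ℝ | ∃ x : α → ℝ, G.IsFeasible x ∧ G.lagrangianPoly x = y} G.lagrangian := by
  classical
  have key : {y : ℝ | ∃ x : α → ℝ, G.IsFeasible x ∧ G.lagrangianPoly x = y} =
      G.lagrangianPoly '' ((Set.univ.pi fun _ : α => Set.Icc (0 : ℝ) 1) ∩
        {x | ∑ i ∈ G.verts, x i = 1}) := by
    ext y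
    constructor
    · rintro ⟨x, ⟨hx0, hx1⟩, rfl⟩
      refine ⟨fun i => if i ∈ G.verts then x i else 0, ⟨?_, ?_⟩, ?_⟩
      · intro i _
        by_cases hi : i ∈ G.verts
        · simp only [hi, if_true]
          exact ⟨hx0 i hi, hx1 ▸ Finset.single_le_sum hx0 hi⟩
        · simp [hi]
      · show ∑ i ∈ G.verts, (if i ∈ G.verts then x i else 0) = 1
        rw [← hx1]
        exact Finset.sum_congr rfl fun i hi => by simp [hi]
      · refine Finset.sum_congr rfl fun e he => Finset.prod_congr rfl fun i hi => ?_
        have := (Finset.mem_powersetCard.1 (G.edges_subset he)).1 hi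
        simp [this]
    · rintro ⟨x, ⟨hx, hx1⟩, rfl⟩
      exact ⟨x, ⟨fun i _ => (hx i trivial).1, hx1⟩, rfl⟩
  have hcomp : IsCompact {y : ℝ | ∃ x : α → ℝ, G.IsFeasible x ∧ G.lagrangianPoly x = y} := by
    rw [key]
    refine IsCompact.image ?_ ?_
    · refine (isCompact_univ_pi fun _ => isCompact_Icc).inter_right ?_
      exact isClosed_eq (by fun_prop) continuous_const
    · unfold lagrangianPoly
      fun_prop
  refine hcomp.isGreatest_sSup ?_
  obtain ⟨v, hv⟩ := hG
  refine ⟨_, fun i => if i = v then 1 else 0, ⟨fun i _ => by positivity, ?_⟩, rfl⟩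
  simp [hv]

/-- The complete `r`-graph `[n]^(r)` on the vertex set `[n] = {1, ..., n}`. -/
def complete (r n : ℕ) : RGraph r ℕ where
  verts := Finset.Icc 1 n
  edges := (Finset.Icc 1 n).powersetCard r
  edges_subset := subset_rfl

/-- The family of all `r`-subsets of the set of positive integers. -/
def posSubsets (r : ℕ) : Set (Finset ℕ) := {A | A.card = r ∧ ∀ a ∈ A, 1 ≤ a}

/-- The first `m` sets in the colex ordering of the `r`-subsets of the positive integers: those
with fewer than `m` predecessors. In the colex ordering, `A` is less than `B` iff `A ≠ B` and the
largest element of their symmetric difference lies in `B`. -/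
def colexFirst (r m : ℕ) : Set (Finset ℕ) :=
  {A | A ∈ posSubsets r ∧ {B | B ∈ posSubsets r ∧ toColex B < toColex A}.encard < m}

theorem finite_colexFirst (r m : ℕ) : (colexFirst r m).Finite := by
  by_contra hinf
  obtain ⟨F, hF, hcard⟩ := Set.Infinite.exists_subset_card_eq hinf (m + 1)
  have hne : F.Nonempty := Finset.card_pos.1 (by omega)
  obtain ⟨A, hA, hmax⟩ := F.exists_max_image (fun B => toColex B) hne
  have hlt := (hF hA).2
  have hsub : ((F.erase A : Finset (Finset ℕ)) : Set (Finset ℕ)) ⊆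
      {B | B ∈ posSubsets r ∧ toColex B < toColex A} := by
    intro B hB
    have hB' := Finset.mem_erase.1 (Finset.mem_coe.1 hB)
    exact ⟨(hF hB'.2).1, lt_of_le_of_ne (hmax B hB'.2) fun h => hB'.1 (by simpa using h)⟩
  have h := (Set.encard_le_encard hsub).trans_lt hlt
  rw [Set.encard_coe_eq_coe_finsetCard, Finset.card_erase_of_mem hA, hcard] at h
  simp at h

/-- The `r`-graph `C_{r,m}` formed by taking the first `m` sets in the colex ordering; its vertices
are the positive integers covered by these sets. -/
noncomputable def colexGraph (r m : ℕ) : RGraph r ℕ where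
  verts := (finite_colexFirst r m).toFinset.biUnion id
  edges := (finite_colexFirst r m).toFinset
  edges_subset := fun A hA => Finset.mem_powersetCard.2
    ⟨fun _ ha => Finset.mem_biUnion.2 ⟨A, hA, ha⟩,
      ((finite_colexFirst r m).mem_toFinset.1 hA).1.1⟩

end RGraph

/-! Put `n = t - 1`. By Pascal's rule the upper bound on `m` says that at least `3n/2 - 1` triples
are missing from the complete 3-graph on `n + 1` vertices, and the lower bound says that `[n]^(3)`
is contained in `C_{3,m}`. So it suffices that `m` triples never beat the Lagrangian
`(n-1)(n-2)/(6n^2)` of `[n]^(3)`.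

Take a family and a weighting that are jointly optimal, with decreasing weights and a
left-compressed family. Two arguments carry the proof.

Descent (`Admissible.exists_last_eq_zero`): while there are more than `n + 1` vertices, move the
last weight onto its neighbour. By stationarity the loss is only of second order. The triples
through the emptied vertex have become useless, and exchanging them for missing triples among the
other vertices makes up for the loss.

The case of `n + 1` vertices (`IsOptimal.wt_le`): merging the last two weights `u, v` of the
complete 3-graph costs exactly `uv(1-u-v)`, and the result is supported on `n` vertices, where
Maclaurin's inequality applies. It remains to see that the missing triples weigh at least
`uv(1-u-v)`. This holds once the weights are not too uneven, and `IsOptimal.lt_mul_of_lt_wt` shows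
that an uneven optimum is already below the bound. -/

namespace RGraph
open Finset

/-! ### Weight polynomials, their derivatives and symmetric functions -/

section Weights

variable {α : Type*}

/-- The total weight of a family of finite sets, each weighted by the product over its elements. -/
def wt (E : Finset (Finset α)) (x : α → ℝ) : ℝ := ∑ e ∈ E, ∏ i ∈ e, x i

theorem wt_mono {E F : Finset (Finset α)} {x : α → ℝ} (hx : ∀ i, 0 ≤ x i) (h : E ⊆ F) :
    wt E x ≤ wt F x :=
  sum_le_sum_of_subset_of_nonneg h fun _ _ _ => prod_nonneg fun i _ => hx i

theorem wt_powersetCard_one (S : Finset α) (x : α → ℝ) :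
    wt (S.powersetCard 1) x = ∑ i ∈ S, x i := by
  simp [wt, powersetCard_one]

variable [DecidableEq α]

/-- The weight of the link of `i`: the partial derivative of `wt E` in direction `i`. -/
def linkWt (E : Finset (Finset α)) (i : α) (x : α → ℝ) : ℝ :=
  ∑ e ∈ E with i ∈ e, ∏ k ∈ e.erase i, x k

/-- The weight of the link of the pair `i, j`: the mixed second derivative of `wt E`. -/
def pairWt (E : Finset (Finset α)) (i j : α) (x : α → ℝ) : ℝ :=
  ∑ e ∈ E with i ∈ e ∧ j ∈ e, ∏ k ∈ (e.erase i).erase j, x k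

/-- The weighting obtained from `x` by moving the amount `ε` from `j` to `i`. -/
def shift (x : α → ℝ) (i j : α) (ε : ℝ) : α → ℝ :=
  Function.update (Function.update x i (x i + ε)) j (x j - ε)

theorem shift_left (x : α → ℝ) {i j : α} (hij : i ≠ j) (ε : ℝ) : shift x i j ε i = x i + ε := by
  simp [shift, hij]

theorem shift_right (x : α → ℝ) (i j : α) (ε : ℝ) : shift x i j ε j = x j - ε := by
  simp [shift]

theorem shift_of_ne (x : α → ℝ) {i j k : α} (hi : k ≠ i) (hj : k ≠ j) (ε : ℝ) :
    shift x i j ε k = x k := by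
  simp [shift, hi, hj]

theorem sum_shift (x : α → ℝ) {i j : α} (hij : i ≠ j) (ε : ℝ) {S : Finset α} (hi : i ∈ S)
    (hj : j ∈ S) : ∑ k ∈ S, shift x i j ε k = ∑ k ∈ S, x k := by
  have hj' : j ∈ S.erase i := mem_erase.2 ⟨hij.symm, hj⟩
  rw [← add_sum_erase S _ hi, ← add_sum_erase _ _ hj', ← add_sum_erase S x hi,
    ← add_sum_erase _ x hj', shift_left x hij, shift_right]
  have : ∑ k ∈ (S.erase i).erase j, shift x i j ε k = ∑ k ∈ (S.erase i).erase j, x k :=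
    sum_congr rfl fun k hk => by
      simp only [mem_erase] at hk
      exact shift_of_ne x hk.2.1 hk.1 ε
  rw [this]
  ring

/-- The expansion stops at second order because `wt E` has degree at most one in each variable. -/
theorem wt_shift (E : Finset (Finset α)) (x : α → ℝ) {i j : α} (hij : i ≠ j) (ε : ℝ) :
    wt E (shift x i j ε) =
      wt E x + ε * (linkWt E i x - linkWt E j x) - ε ^ 2 * pairWt E i j x := by
  simp only [wt, linkWt, pairWt, sum_filter]
  rw [← sum_sub_distrib, mul_sum, mul_sum, ← sum_add_distrib, ← sum_sub_distrib]
  refine sum_congr rfl fun e _ => ?_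
  have hrest : ∀ T : Finset α, i ∉ T → j ∉ T → ∏ k ∈ T, shift x i j ε k = ∏ k ∈ T, x k :=
    fun T hi hj => prod_congr rfl fun k hk =>
      shift_of_ne x (ne_of_mem_of_not_mem hk hi) (ne_of_mem_of_not_mem hk hj) ε
  by_cases hi : i ∈ e <;> by_cases hj : j ∈ e
  · have hj' : j ∈ e.erase i := mem_erase.2 ⟨hij.symm, hj⟩
    have hi' : i ∈ e.erase j := mem_erase.2 ⟨hij, hi⟩
    rw [← mul_prod_erase e _ hi, ← mul_prod_erase _ _ hj', hrest _ (by simp) (by simp),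
      ← mul_prod_erase e x hi, ← mul_prod_erase _ x hj', shift_left x hij, shift_right,
      ← mul_prod_erase (e.erase j) x hi', erase_right_comm (a := j)]
    simp only [hi, hj, if_true, and_self]
    ring
  · rw [← mul_prod_erase e _ hi, hrest _ (by simp) (by simp [hj]), ← mul_prod_erase e x hi,
      shift_left x hij]
    simp only [hi, hj, if_true, if_false, and_false]
    ring
  · rw [← mul_prod_erase e _ hj, hrest _ (by simp [hi]) (by simp), ← mul_prod_erase e x hj,
      shift_right]
    simp only [hi, hj, if_true, if_false, false_and]
    ring
  · rw [hrest _ hi hj]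
    simp [hi, hj]

theorem wt_union {E F : Finset (Finset α)} (h : Disjoint E F) (x : α → ℝ) :
    wt (E ∪ F) x = wt E x + wt F x := sum_union h

theorem wt_sdiff_add {E F : Finset (Finset α)} (h : E ⊆ F) (x : α → ℝ) :
    wt (F \ E) x + wt E x = wt F x := sum_sdiff h

theorem linkWt_nonneg {E : Finset (Finset α)} {x : α → ℝ} (hx : ∀ i, 0 ≤ x i) (i : α) :
    0 ≤ linkWt E i x :=
  sum_nonneg fun _ _ => prod_nonneg fun i _ => hx i

theorem linkWt_mono {E F : Finset (Finset α)} {x : α → ℝ} (hx : ∀ i, 0 ≤ x i) (h : E ⊆ F)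
    (i : α) : linkWt E i x ≤ linkWt F i x :=
  sum_le_sum_of_subset_of_nonneg (filter_subset_filter _ h) fun _ _ _ =>
    prod_nonneg fun i _ => hx i

theorem linkWt_sdiff_add {E F : Finset (Finset α)} (h : E ⊆ F) (i : α) (x : α → ℝ) :
    linkWt (F \ E) i x + linkWt E i x = linkWt F i x := by
  simp only [linkWt, sum_filter]
  exact sum_sdiff h

theorem pairWt_sdiff_add {E F : Finset (Finset α)} (h : E ⊆ F) (i j : α) (x : α → ℝ) :
    pairWt (F \ E) i j x + pairWt E i j x = pairWt F i j x := by
  simp only [pairWt, sum_filter]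
  exact sum_sdiff h

/-- Euler's identity for the homogeneous polynomial `wt E`. -/
theorem sum_mul_linkWt {r : ℕ} {S : Finset α} {E : Finset (Finset α)}
    (hE : E ⊆ S.powersetCard r) (x : α → ℝ) :
    ∑ i ∈ S, x i * linkWt E i x = r * wt E x := by
  simp only [linkWt, wt, sum_filter, mul_sum]
  rw [sum_comm]
  refine sum_congr rfl fun e he => ?_
  obtain ⟨heS, hcard⟩ := mem_powersetCard.1 (hE he)
  have h1 : ∀ i ∈ S, x i * (if i ∈ e then ∏ k ∈ e.erase i, x k else 0) =
      if i ∈ e then ∏ k ∈ e, x k else 0 := by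
    intro i _
    split_ifs with h
    · exact mul_prod_erase e x h
    · simp
  rw [sum_congr rfl h1, ← sum_filter, sum_const, filter_mem_eq_inter,
    inter_eq_right.2 heS, hcard, nsmul_eq_mul]

theorem filter_mem_powersetCard_succ {S : Finset α} {i : α} (hi : i ∈ S) (r : ℕ) :
    ((S.powersetCard (r + 1)).filter (i ∈ ·)) = ((S.erase i).powersetCard r).image (insert i) := by
  ext e
  simp only [mem_filter, mem_powersetCard, mem_image]
  constructor
  · rintro ⟨⟨hS, hc⟩, hie⟩
    exact ⟨e.erase i, ⟨erase_subset_erase i hS, by rw [card_erase_of_mem hie, hc]; rfl⟩,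
      insert_erase hie⟩
  · rintro ⟨f, ⟨hf, hc⟩, rfl⟩
    have hif : i ∉ f := fun h => by simpa using hf h
    exact ⟨⟨insert_subset hi (hf.trans (erase_subset _ _)), by rw [card_insert_of_notMem hif, hc]⟩,
      mem_insert_self _ _⟩

theorem linkWt_powersetCard_succ {S : Finset α} {i : α} (hi : i ∈ S) (r : ℕ) (x : α → ℝ) :
    linkWt (S.powersetCard (r + 1)) i x = wt ((S.erase i).powersetCard r) x := by
  have hni : ∀ f ∈ (S.erase i).powersetCard r, i ∉ f := fun f hf h => by
    simpa using (mem_powersetCard.1 hf).1 h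
  rw [linkWt, filter_mem_powersetCard_succ hi, sum_image, wt]
  · exact sum_congr rfl fun f hf => by rw [erase_insert (hni f hf)]
  · intro f hf g hg h
    rw [← erase_insert (hni f hf), ← erase_insert (hni g hg)]
    exact congrArg (fun s => erase s i) h

theorem wt_powersetCard_insert {S : Finset α} {i : α} (hi : i ∉ S) (r : ℕ) (x : α → ℝ) :
    wt ((insert i S).powersetCard (r + 1)) x =
      wt (S.powersetCard (r + 1)) x + x i * wt (S.powersetCard r) x := by
  have hni : ∀ f ∈ S.powersetCard r, i ∉ f := fun f hf h => hi ((mem_powersetCard.1 hf).1 h)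
  rw [powersetCard_succ_insert hi, wt_union]
  · congr 1
    rw [wt, sum_image, wt, mul_sum]
    · exact sum_congr rfl fun f hf => prod_insert (hni f hf)
    · intro f hf g hg h
      rw [← erase_insert (hni f hf), ← erase_insert (hni g hg)]
      exact congrArg (fun s => erase s i) h
  · refine disjoint_left.2 fun e he he' => ?_
    obtain ⟨f, _, rfl⟩ := mem_image.1 he'
    exact hi ((mem_powersetCard.1 he).1 (mem_insert_self _ _))

theorem two_mul_wt_powersetCard_two (S : Finset α) (x : α → ℝ) :
    2 * wt (S.powersetCard 2) x = (∑ i ∈ S, x i) ^ 2 - ∑ i ∈ S, x i ^ 2 := by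
  induction S using Finset.induction_on with
  | empty => rw [powersetCard_eq_empty.2 (by simp)]; simp [wt]
  | insert a S ha ih =>
    rw [wt_powersetCard_insert ha, wt_powersetCard_one, sum_insert ha, sum_insert ha, mul_add, ih]
    ring

theorem six_mul_wt_powersetCard_three (S : Finset α) (x : α → ℝ) :
    6 * wt (S.powersetCard 3) x = (∑ i ∈ S, x i) ^ 3 -
      3 * (∑ i ∈ S, x i) * (∑ i ∈ S, x i ^ 2) + 2 * ∑ i ∈ S, x i ^ 3 := by
  induction S using Finset.induction_on with
  | empty => rw [powersetCard_eq_empty.2 (by simp)]; simp [wt]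
  | insert a S ha ih =>
    have h2 := two_mul_wt_powersetCard_two S x
    rw [wt_powersetCard_insert ha, sum_insert ha, sum_insert ha, sum_insert ha, mul_add, ih]
    linear_combination 3 * x a * h2

/-- Maclaurin's inequality for the third elementary symmetric polynomial. -/
theorem wt_powersetCard_three_le {S : Finset α} {n : ℕ} (hn : 4 ≤ n) (hS : S.card = n)
    {x : α → ℝ} (hx : ∀ i ∈ S, 0 ≤ x i) (hsum : ∑ i ∈ S, x i = 1) :
    wt (S.powersetCard 3) x ≤ ((n : ℝ) - 1) * (n - 2) / (6 * n ^ 2) := by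
  have h6 := six_mul_wt_powersetCard_three S x
  have hn' : (4 : ℝ) ≤ n := by exact_mod_cast hn
  -- Tangent line at `1/n` to `2t^3 - 3t^2`, the one-variable part of `6 e_3` when the weights sum
  -- to `1`. The gap factors as `(t - c)^2 (3 - 2t - 4c)` with `c = 1/n`; it is nonnegative since `t
  -- ≤ 1` and `c ≤ 1/4`.
  have key : ∀ i ∈ S, 2 * x i ^ 3 - 3 * x i ^ 2 ≤
      2 / (n : ℝ) ^ 3 - 3 / (n : ℝ) ^ 2 + (6 / (n : ℝ) ^ 2 - 6 / n) * (x i - 1 / n) := by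
    intro i hi
    have h0 := hx i hi
    have h1 : x i ≤ 1 := hsum ▸ single_le_sum hx hi
    have hinv : (1 : ℝ) / n ≤ 1 / 4 := one_div_le_one_div_of_le (by norm_num) hn'
    have hpos : 0 < (1 : ℝ) / n := by positivity
    have e1 : (2 : ℝ) / (n : ℝ) ^ 3 = 2 * (1 / n) ^ 3 := by ring
    have e2 : (3 : ℝ) / (n : ℝ) ^ 2 = 3 * (1 / n) ^ 2 := by ring
    have e3 : (6 : ℝ) / (n : ℝ) ^ 2 = 6 * (1 / n) ^ 2 := by ring
    have e4 : (6 : ℝ) / n = 6 * (1 / n) := by ring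
    rw [e1, e2, e3, e4]
    generalize (1 : ℝ) / n = c at *
    have : 0 ≤ (x i - c) ^ 2 * (3 - 2 * x i - 4 * c) :=
      mul_nonneg (sq_nonneg _) (by linarith)
    nlinarith
  have hs := sum_le_sum key
  rw [sum_sub_distrib, ← mul_sum, ← mul_sum, sum_add_distrib, ← mul_sum, sum_sub_distrib,
    sum_sub_distrib, hsum, sum_const, sum_const, sum_const, hS, nsmul_eq_mul, nsmul_eq_mul,
    nsmul_eq_mul] at hs
  rw [hsum] at h6
  have hz : (1 : ℝ) - n * (1 / n) = 0 := by field_simp; ring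
  rw [hz] at hs
  have : (n : ℝ) * (2 / (n : ℝ) ^ 3 - 3 / (n : ℝ) ^ 2) =
      6 * (((n : ℝ) - 1) * (n - 2) / (6 * n ^ 2)) - 1 := by
    field_simp; ring
  linarith

theorem pairWt_eq_sum {S : Finset α} {E : Finset (Finset α)} (hE : E ⊆ S.powersetCard 3)
    {i j : α} (hij : i ≠ j) (x : α → ℝ) :
    pairWt E i j x = ∑ k ∈ (S.erase i).erase j with {k, i, j} ∈ E, x k := by
  symm
  refine sum_bij (fun k _ => {k, i, j}) ?_ ?_ ?_ ?_
  · intro k hk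
    simpa using (mem_filter.1 hk).2
  · intro k hk l hl h
    simp only [mem_filter, mem_erase] at hk hl
    have : k ∈ ({l, i, j} : Finset α) := h ▸ mem_insert_self _ _
    simp only [mem_insert, mem_singleton] at this
    tauto
  · intro e he
    simp only [mem_filter] at he
    obtain ⟨heE, hi, hj⟩ := he
    obtain ⟨heS, hcard⟩ := mem_powersetCard.1 (hE heE)
    have hj' : j ∈ e.erase i := mem_erase.2 ⟨hij.symm, hj⟩
    have hc : ((e.erase i).erase j).card = 1 := by
      rw [card_erase_of_mem hj', card_erase_of_mem hi, hcard]
    obtain ⟨k, hk⟩ := card_eq_one.1 hc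
    have hek : e = {k, i, j} := by
      rw [← insert_erase hi, ← insert_erase hj', hk]
      ext a; simp only [mem_insert, mem_singleton]; tauto
    have hk' : k ∈ (e.erase i).erase j := hk ▸ mem_singleton_self k
    simp only [mem_erase] at hk'
    exact ⟨k, by simp only [mem_filter, mem_erase]; exact ⟨⟨hk'.1, hk'.2.1, heS hk'.2.2⟩, hek ▸ heE⟩,
      hek.symm⟩
  · intro k hk
    simp only [mem_filter, mem_erase] at hk
    have : (({k, i, j} : Finset α).erase i).erase j = {k} := by
      ext a; simp only [mem_insert, mem_singleton, mem_erase]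
      constructor
      · tauto
      · rintro rfl; tauto
    rw [this, prod_singleton]

theorem triple_mem_powersetCard {S : Finset α} {i j k : α} (hi : i ∈ S) (hj : j ∈ S) (hk : k ∈ S)
    (hij : i ≠ j) (hik : i ≠ k) (hjk : j ≠ k) : {i, j, k} ∈ S.powersetCard 3 := by
  rw [mem_powersetCard]
  exact ⟨by simp [insert_subset_iff, hi, hj, hk], card_eq_three.2 ⟨i, j, k, hij, hik, hjk, rfl⟩⟩

theorem pairWt_powersetCard {S : Finset α} {i j : α} (hi : i ∈ S) (hj : j ∈ S) (hij : i ≠ j)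
    (x : α → ℝ) : pairWt (S.powersetCard 3) i j x = ∑ k ∈ S, x k - x i - x j := by
  rw [pairWt_eq_sum subset_rfl hij, filter_true_of_mem, ← add_sum_erase S x hi,
    ← add_sum_erase _ x (mem_erase.2 ⟨hij.symm, hj⟩)]
  · ring
  · intro k hk
    simp only [mem_erase] at hk
    exact triple_mem_powersetCard hk.2.2 hi hj hk.2.1 hk.1 hij

theorem two_mul_linkWt_powersetCard {S : Finset α} {i : α} (hi : i ∈ S) {x : α → ℝ}
    (hsum : ∑ k ∈ S, x k = 1) :
    2 * linkWt (S.powersetCard 3) i x = 1 - 2 * x i + 2 * x i ^ 2 - ∑ k ∈ S, x k ^ 2 := by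
  rw [linkWt_powersetCard_succ hi, two_mul_wt_powersetCard_two]
  have h1 := add_sum_erase S x hi
  have h2 := add_sum_erase S (fun k => x k ^ 2) hi
  have h3 : ∑ k ∈ S.erase i, x k = 1 - x i := by linarith
  rw [h3, ← h2]
  ring

end Weights
end RGraph

namespace RGraph
open Finset

/-! ### Optimal pairs of a family and a weighting -/

section Optimal

/-- `E` is a family of at most `m` triples from `{0, ..., s - 1}` and `x` is a point of the standard
simplex on this set. -/
structure Admissible (m s : ℕ) (E : Finset (Finset ℕ)) (x : ℕ → ℝ) : Prop where
  subset : E ⊆ (range s).powersetCard 3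
  card_le : E.card ≤ m
  nonneg : ∀ i, 0 ≤ x i
  eq_zero : ∀ i, s ≤ i → x i = 0
  sum_eq : ∑ i ∈ range s, x i = 1

/-- An admissible pair of largest weight. -/
structure IsOptimal (m s : ℕ) (E : Finset (Finset ℕ)) (x : ℕ → ℝ) : Prop
    extends Admissible m s E x where
  le : ∀ E' x', Admissible m s E' x' → wt E' x' ≤ wt E x

/-- There are finitely many families, and for each one the weight is continuous on a compact
simplex: take the best point for every family, then the best family. -/
theorem Admissible.exists_isOptimal {m s : ℕ} {E₀ : Finset (Finset ℕ)} {x₀ : ℕ → ℝ}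
    (h₀ : Admissible m s E₀ x₀) : ∃ E x, IsOptimal m s E x := by
  -- Coordinates from `s` on are confined to `[0, 0]`, so compactness holds in `ℕ → ℝ` by Tychonoff.
  set Δ : Set (ℕ → ℝ) := (Set.univ.pi fun i : ℕ => Set.Icc (0 : ℝ) (if i < s then 1 else 0)) ∩
    {x | ∑ i ∈ range s, x i = 1} with hΔ
  have hcomp : IsCompact Δ :=
    (isCompact_univ_pi fun _ => isCompact_Icc).inter_right
      (isClosed_eq (by fun_prop) continuous_const)
  have hmem : ∀ E x, Admissible m s E x → x ∈ Δ := by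
    refine fun E x h => ⟨fun i _ => ⟨h.nonneg i, ?_⟩, h.sum_eq⟩
    split_ifs with hi
    · exact h.sum_eq ▸ single_le_sum (fun j _ => h.nonneg j) (mem_range.2 hi)
    · exact (h.eq_zero i (not_lt.1 hi)).le
  have hadm : ∀ E ∈ ((range s).powersetCard 3).powerset.filter (fun E => E.card ≤ m),
      ∀ x ∈ Δ, Admissible m s E x := by
    intro E hE x hx
    rw [mem_filter, mem_powerset] at hE
    refine ⟨hE.1, hE.2, fun i => (hx.1 i trivial).1, fun i hi => ?_, hx.2⟩
    have h : x i ∈ Set.Icc (0 : ℝ) (if i < s then 1 else 0) := hx.1 i trivial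
    rw [if_neg (not_lt.2 hi)] at h
    exact le_antisymm h.2 h.1
  have hmax : ∀ E : Finset (Finset ℕ), ∃ x ∈ Δ, IsMaxOn (wt E) Δ x := fun E =>
    hcomp.exists_isMaxOn ⟨x₀, hmem _ _ h₀⟩ (by unfold wt; fun_prop)
  choose y hyΔ hymax using hmax
  obtain ⟨E, hE, hEmax⟩ := exists_max_image
    (((range s).powersetCard 3).powerset.filter (fun E => E.card ≤ m)) (fun E => wt E (y E))
    ⟨E₀, mem_filter.2 ⟨mem_powerset.2 h₀.subset, h₀.card_le⟩⟩
  refine ⟨E, y E, hadm E hE _ (hyΔ E), fun E' x' h' => ?_⟩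
  exact (hymax E' (hmem _ _ h')).trans
    (hEmax E' (mem_filter.2 ⟨mem_powerset.2 h'.subset, h'.card_le⟩))

/-- A weighted family of triples can be relabelled so that the weights are decreasing. -/
theorem exists_admissible_antitone {α : Type*} [DecidableEq α] {m : ℕ} {V : Finset α}
    {E : Finset (Finset α)} {x : α → ℝ} (hE : E ⊆ V.powersetCard 3) (hm : E.card ≤ m)
    (hx : ∀ i ∈ V, 0 ≤ x i) (hsum : ∑ i ∈ V, x i = 1) :
    ∃ E' x', Admissible m V.card E' x' ∧ Antitone x' ∧ wt E' x' = wt E x := by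
  obtain ⟨g, hg⟩ : ∃ g : Fin V.card ≃ V, ∀ i j, i ≤ j → x (g j) ≤ x (g i) := by
    refine ⟨(Tuple.sort fun i => -x (V.equivFin.symm i)).trans V.equivFin.symm, fun i j hij => ?_⟩
    have := Tuple.monotone_sort (fun i => -x (V.equivFin.symm i)) hij
    simpa using this
  set x' : ℕ → ℝ := fun n => if h : n < V.card then x (g ⟨n, h⟩) else 0 with hx'
  set f : α → ℕ := fun a => if h : a ∈ V then (g.symm ⟨a, h⟩ : ℕ) else 0 with hf
  have hfV : ∀ a ∈ V, f a < V.card := fun a ha => by simp [hf, ha]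
  have hxf : ∀ a ∈ V, x' (f a) = x a := fun a ha => by simp [hx', hf, ha]
  have hinj : Set.InjOn f V := by
    intro a ha b hb hab
    rw [mem_coe] at ha hb
    simp only [hf, ha, hb, dif_pos] at hab
    simpa using g.symm.injective (Fin.ext hab)
  have himg : V.image f = range V.card := by
    refine eq_of_subset_of_card_le (fun n hn => ?_) ?_
    · obtain ⟨a, ha, rfl⟩ := mem_image.1 hn
      exact mem_range.2 (hfV a ha)
    · rw [card_range, card_image_of_injOn hinj]
  have hEV : ∀ e ∈ E, e ⊆ V := fun e he => (mem_powersetCard.1 (hE he)).1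
  refine ⟨E.image (image f), x', ⟨?_, card_image_le.trans hm, ?_, ?_, ?_⟩, ?_, ?_⟩
  · intro e' he'
    obtain ⟨e, he, rfl⟩ := mem_image.1 he'
    rw [mem_powersetCard, ← himg]
    exact ⟨image_subset_image (hEV e he), by
      rw [card_image_of_injOn (hinj.mono (coe_subset.2 (hEV e he))),
        (mem_powersetCard.1 (hE he)).2]⟩
  · intro n
    simp only [hx']
    split_ifs with h
    · exact hx _ (g ⟨n, h⟩).2
    · exact le_rfl
  · intro n hn
    simp [hx', not_lt.2 hn]
  · rw [← himg, sum_image hinj, ← hsum]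
    exact sum_congr rfl hxf
  · intro i j hij
    simp only [hx']
    split_ifs with h1 h2 h2
    · exact hg _ _ (by simpa using hij)
    · omega
    · exact hx _ (g ⟨i, h2⟩).2
    · exact le_rfl
  · rw [wt, sum_image, wt]
    · refine sum_congr rfl fun e he => ?_
      rw [prod_image (hinj.mono (coe_subset.2 (hEV e he)))]
      exact prod_congr rfl fun a ha => hxf a (hEV e he ha)
    · intro e he e' he' h
      ext a
      have key : ∀ e₁ ∈ E, ∀ e₂ ∈ E, image f e₁ = image f e₂ → a ∈ e₁ → a ∈ e₂ := by
        intro e₁ h₁ e₂ h₂ h₁₂ ha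
        have : f a ∈ image f e₂ := h₁₂ ▸ mem_image_of_mem f ha
        obtain ⟨b, hb, hab⟩ := mem_image.1 this
        rwa [← hinj (hEV _ h₂ hb) (hEV _ h₁ ha) hab]
      exact ⟨key e he e' he' h, key e' he' e he h.symm⟩

theorem Admissible.mono {m s s' : ℕ} {E : Finset (Finset ℕ)} {x : ℕ → ℝ}
    (h : Admissible m s E x) (hs : s ≤ s') : Admissible m s' E x where
  subset := h.subset.trans (powersetCard_mono (range_subset_range.2 hs))
  card_le := h.card_le
  nonneg := h.nonneg
  eq_zero i hi := h.eq_zero i (hs.trans hi)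
  sum_eq := by
    rw [← h.sum_eq]
    exact (sum_subset (range_subset_range.2 hs) fun i _ hi =>
      h.eq_zero i (by simpa using hi)).symm

/-- `E` is left-compressed. -/
def LeftCompressed (E : Finset (Finset ℕ)) : Prop :=
  ∀ e ∈ E, ∀ i j, i < j → j ∈ e → i ∉ e → insert i (e.erase j) ∈ E

/-- Replacing a triple by one that is further to the left changes neither the number of triples
nor, at an antitone weighting, the optimality. Hence there is a left-compressed optimum. -/
theorem Admissible.exists_isOptimal_leftCompressed {m s : ℕ} {E₀ : Finset (Finset ℕ)}
    {x₀ : ℕ → ℝ} (h₀ : Admissible m s E₀ x₀) :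
    ∃ E x, IsOptimal m s E x ∧ Antitone x ∧ LeftCompressed E := by
  obtain ⟨E₁, x₁, h₁⟩ := h₀.exists_isOptimal
  obtain ⟨E₂, x, h₂, hanti, hwt⟩ := exists_admissible_antitone h₁.subset h₁.card_le
    (fun i _ => h₁.nonneg i) h₁.sum_eq
  rw [card_range] at h₂
  have hopt₂ : IsOptimal m s E₂ x := ⟨h₂, fun E' x' h' => (h₁.le E' x' h').trans hwt.ge⟩
  classical
  -- Among the optimal families for `x`, minimise the sum of all vertex labels; a possible
  -- compression would lower it strictly.
  obtain ⟨E, hE, hmin⟩ := exists_min_image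
    (((range s).powersetCard 3).powerset.filter fun E => IsOptimal m s E x)
    (fun E => ∑ e ∈ E, ∑ i ∈ e, i) ⟨E₂, mem_filter.2 ⟨mem_powerset.2 h₂.subset, hopt₂⟩⟩
  have hopt := (mem_filter.1 hE).2
  refine ⟨E, x, hopt, hanti, fun e he i j hij hj hi => ?_⟩
  by_contra hnot
  obtain ⟨heS, hcard⟩ := mem_powersetCard.1 (hopt.subset he)
  have hi' : i ∉ e.erase j := fun h => hi (mem_of_mem_erase h)
  have hnot' : insert i (e.erase j) ∉ E.erase e := fun h => hnot (mem_of_mem_erase h)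
  have hcardE : (insert (insert i (e.erase j)) (E.erase e)).card = E.card := by
    rw [card_insert_of_notMem hnot', card_erase_of_mem he]
    have := card_pos.2 ⟨e, he⟩
    omega
  have hadm : Admissible m s (insert (insert i (e.erase j)) (E.erase e)) x := by
    refine ⟨insert_subset ?_ ((erase_subset _ _).trans hopt.subset), hcardE.le.trans hopt.card_le,
      hopt.nonneg, hopt.eq_zero, hopt.sum_eq⟩
    rw [mem_powersetCard]
    refine ⟨insert_subset (mem_range.2 (hij.trans (mem_range.1 (heS hj))))
      ((erase_subset _ _).trans heS), ?_⟩
    rw [card_insert_of_notMem hi', card_erase_of_mem hj, hcard]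
  have hge : wt E x ≤ wt (insert (insert i (e.erase j)) (E.erase e)) x := by
    rw [wt, wt, sum_insert hnot', ← add_sum_erase E _ he, prod_insert hi',
      ← mul_prod_erase e x hj]
    gcongr
    · exact prod_nonneg fun k _ => hopt.nonneg k
    · exact hanti hij.le
  have hopt' : IsOptimal m s (insert (insert i (e.erase j)) (E.erase e)) x :=
    ⟨hadm, fun E' x' h' => (hopt.le E' x' h').trans hge⟩
  have := hmin _ (mem_filter.2 ⟨mem_powerset.2 hadm.subset, hopt'⟩)
  rw [sum_insert hnot', ← add_sum_erase E _ he, sum_insert hi', ← add_sum_erase e _ hj] at this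
  omega

/-- Moving a small amount of weight between two vertices keeps admissibility. -/
theorem Admissible.shift {m s : ℕ} {E : Finset (Finset ℕ)} {x : ℕ → ℝ}
    (h : Admissible m s E x) {i j : ℕ} (hij : i ≠ j) (hi : i < s) (hj : j < s) {ε : ℝ}
    (h0 : 0 ≤ ε) (hε : ε ≤ x j) : Admissible m s E (shift x i j ε) where
  subset := h.subset
  card_le := h.card_le
  nonneg k := by
    by_cases hkj : k = j
    · rw [hkj, shift_right]; linarith
    by_cases hki : k = i
    · rw [hki, shift_left x hij]; linarith [h.nonneg i]
    rw [shift_of_ne x hki hkj]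
    exact h.nonneg k
  eq_zero k hk := by
    rw [shift_of_ne x (by omega) (by omega)]
    exact h.eq_zero k hk
  sum_eq := by
    rw [sum_shift x hij ε (mem_range.2 hi) (mem_range.2 hj), h.sum_eq]

/-- First-order optimality: if the derivative at `i` were larger, moving a little weight from `j` to
`i` would gain. Between two vertices of positive weight this gives equality. -/
theorem IsOptimal.linkWt_le {m s : ℕ} {E : Finset (Finset ℕ)} {x : ℕ → ℝ}
    (h : IsOptimal m s E x) {i j : ℕ} (hi : i < s) (hj : j < s) (hpos : 0 < x j) :
    linkWt E i x ≤ linkWt E j x := by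
  by_cases hij : i = j
  · rw [hij]
  by_contra! hlt
  set d := linkWt E i x - linkWt E j x with hd
  set P := pairWt E i j x with hP
  have hd0 : 0 < d := by linarith
  have hP1 : 0 < |P| + 1 := by positivity
  -- Small enough that the quadratic term `ε^2 P` uses up at most half of the linear gain `ε d`.
  set ε := min (x j) (d / (2 * (|P| + 1))) with hε
  have hε0 : 0 < ε := lt_min hpos (by positivity)
  have h1 := h.le _ _ (h.shift hij hi hj hε0.le (min_le_left _ _))
  rw [wt_shift E x hij ε, ← hd, ← hP] at h1
  have h2 : ε * (2 * (|P| + 1)) ≤ d := by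
    rw [← le_div_iff₀ (by positivity)]; exact min_le_right _ _
  have h3 : ε * P ≤ ε * |P| := mul_le_mul_of_nonneg_left (le_abs_self P) hε0.le
  nlinarith [mul_pos hε0 hd0]

end Optimal
end RGraph

namespace RGraph
open Finset

/-! ### The case of `n + 1` vertices -/

section FewVertices

theorem exists_lt_lt_eq_of_card_eq_three {e : Finset ℕ} (he : e.card = 3) :
    ∃ i j l, i < j ∧ j < l ∧ e = {i, j, l} := by
  have h : ∀ k : Fin 3, e.orderEmbOfFin he k ∈ e := e.orderEmbOfFin_mem he
  have h01 : e.orderEmbOfFin he 0 < e.orderEmbOfFin he 1 := by simp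
  have h12 : e.orderEmbOfFin he 1 < e.orderEmbOfFin he 2 := by simp
  refine ⟨_, _, _, h01, h12, (eq_of_subset_of_card_le ?_ ?_).symm⟩
  · simp [insert_subset_iff, h]
  · rw [he, card_eq_three.2 ⟨_, _, _, h01.ne, (h01.trans h12).ne, h12.ne, rfl⟩]

theorem wt_filter_notMem {α : Type*} [DecidableEq α] (E : Finset (Finset α)) {x : α → ℝ} {q : α}
    (hx : x q = 0) : wt (E.filter (q ∉ ·)) x = wt E x := by
  rw [wt, wt, sum_filter]
  refine sum_congr rfl fun e _ => ?_
  by_cases h : q ∈ e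
  · simp [h, prod_eq_zero h hx]
  · simp [h]

theorem filter_notMem_subset {s r : ℕ} {E : Finset (Finset ℕ)}
    (hE : E ⊆ (range (s + 1)).powersetCard r) :
    E.filter (s ∉ ·) ⊆ (range s).powersetCard r := by
  intro e he
  rw [mem_filter] at he
  obtain ⟨h1, h2⟩ := mem_powersetCard.1 (hE he.1)
  refine mem_powersetCard.2 ⟨fun i hi => ?_, h2⟩
  have := mem_range.1 (h1 hi)
  have : i ≠ s := fun h => he.2 (h ▸ hi)
  exact mem_range.2 (by omega)

/-- The numerical inequality behind the case of one additional vertex. -/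
theorem one_additional_vertex_aux {n a δ : ℝ} (hn : 4 ≤ n) (ha : 0 < a) (hδ : (3 * n - 2) * δ = n)
    (hU : 4 * δ * a ≤ (n + 1) * a - 1) (hlt : a * (n - 1) < 1) :
    1 - 4 * a + (n + 3 - 4 * δ ^ 2) * a ^ 2 ≤ (n - 1) * (n - 2) / n ^ 2 := by
  have hd : 0 < 3 * n - 2 := by linarith
  -- In terms of `t = n - 4` the two quartics below have nonnegative coefficients.
  obtain ⟨t, rfl⟩ : ∃ t, n = 4 + t := ⟨n - 4, by ring⟩
  have ht : 0 ≤ t := by linarith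
  generalize hN : 4 + t = n at *
  -- In `s = 1/a` the claim says that a convex quadratic is nonpositive. The hypotheses place `s`
  -- between `n - 1` and `n + 1 - 4δ`, so it is enough to check these endpoints (`hl`, `hr`).
  obtain ⟨s, hs⟩ : ∃ s, s * a = 1 := ⟨1 / a, by field_simp⟩
  have hsl : n - 1 < s := by
    by_contra! h
    nlinarith [mul_le_mul_of_nonneg_right h ha.le]
  have hsr : s ≤ n + 1 - 4 * δ := by
    by_contra! h
    nlinarith [mul_lt_mul_of_pos_right h ha]
  have hl : (3 * n - 2) * (n - 1) ^ 2 - 4 * n ^ 2 * (n - 1) + n ^ 2 * (n + 3 - 4 * δ ^ 2) ≤ 0 := by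
    have : (3 * n - 2) ^ 2 * ((3 * n - 2) * (n - 1) ^ 2 - 4 * n ^ 2 * (n - 1) +
        n ^ 2 * (n + 3 - 4 * δ ^ 2)) = -(13 * n ^ 4 - 75 * n ^ 3 + 106 * n ^ 2 - 52 * n + 8) := by
      linear_combination (-4 * n ^ 2) * ((3 * n - 2) * δ + n) * hδ
    have h2 : 0 ≤ 13 * n ^ 4 - 75 * n ^ 3 + 106 * n ^ 2 - 52 * n + 8 := by
      rw [← hN]; ring_nf; positivity
    by_contra! h
    have := mul_pos (pow_pos hd 2) h
    linarith
  have hr : (3 * n - 2) * (n + 1 - 4 * δ) ^ 2 - 4 * n ^ 2 * (n + 1 - 4 * δ) +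
      n ^ 2 * (n + 3 - 4 * δ ^ 2) ≤ 0 := by
    have : (3 * n - 2) ^ 2 * ((3 * n - 2) * (n + 1 - 4 * δ) ^ 2 - 4 * n ^ 2 * (n + 1 - 4 * δ) +
        n ^ 2 * (n + 3 - 4 * δ ^ 2)) = -(n ^ 4 + 5 * n ^ 3 - 38 * n ^ 2 + 12 * n + 8) := by
      linear_combination (16 * (3 * n - 2) * ((3 * n - 2) * δ + n) -
        8 * (n + 1) * (3 * n - 2) ^ 2 + 16 * n ^ 2 * (3 * n - 2) -
        4 * n ^ 2 * ((3 * n - 2) * δ + n)) * hδ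
    have h2 : 0 ≤ n ^ 4 + 5 * n ^ 3 - 38 * n ^ 2 + 12 * n + 8 := by
      rw [← hN]; ring_nf; positivity
    by_contra! h
    have := mul_pos (pow_pos hd 2) h
    linarith
  have hg : (3 * n - 2) * s ^ 2 - 4 * n ^ 2 * s + n ^ 2 * (n + 3 - 4 * δ ^ 2) ≤ 0 := by
    generalize n + 1 - 4 * δ = r at *
    generalize n - 1 = l at *
    generalize n ^ 2 * (n + 3 - 4 * δ ^ 2) = c at *
    have hlr : 0 < r - l := by linarith
    -- Convexity: on `[l, r]` the square lies below its chord, `s^2 ≤ (l + r)s - lr`.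
    have h1 : (3 * n - 2) * s ^ 2 ≤ (3 * n - 2) * ((l + r) * s - l * r) :=
      mul_le_mul_of_nonneg_left (by nlinarith) hd.le
    have h2 := mul_nonneg (sub_nonneg.2 hsr) (neg_nonneg.2 hl)
    have h3 := mul_nonneg (sub_nonneg.2 hsl.le) (neg_nonneg.2 hr)
    by_contra! h
    have h4 := mul_pos hlr (h.trans_le (show _ ≤
      (3 * n - 2) * ((l + r) * s - l * r) - 4 * n ^ 2 * s + c by linarith))
    nlinarith
  rw [le_div_iff₀ (by positivity)]
  have : a ^ 2 * ((3 * n - 2) * s ^ 2 - 4 * n ^ 2 * s + n ^ 2 * (n + 3 - 4 * δ ^ 2)) =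
      (1 - 4 * a + (n + 3 - 4 * δ ^ 2) * a ^ 2) * n ^ 2 - (n - 1) * (n - 2) := by
    linear_combination ((3 * n - 2) * (s * a + 1) - 4 * n ^ 2 * a) * hs
  have h5 := mul_nonneg (sq_nonneg a) (neg_nonneg.2 hg)
  linarith

/-- By Euler's identity `3 wt E x` is the `x`-average of the link weights, none of which exceeds
that of `j`. -/
theorem IsOptimal.three_mul_wt_le {m s : ℕ} {E : Finset (Finset ℕ)} {x : ℕ → ℝ}
    (h : IsOptimal m s E x) {j : ℕ} (hj : j < s) (hpos : 0 < x j) :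
    3 * wt E x ≤ linkWt E j x := by
  have h1 := sum_mul_linkWt h.subset x
  push_cast at h1
  rw [← h1]
  calc ∑ i ∈ range s, x i * linkWt E i x ≤ ∑ i ∈ range s, x i * linkWt E j x :=
        sum_le_sum fun i hi =>
          mul_le_mul_of_nonneg_left (h.linkWt_le (mem_range.1 hi) hj hpos) (h.nonneg i)
    _ = linkWt E j x := by rw [← sum_mul, h.sum_eq, one_mul]

theorem Admissible.zero_pos {m s : ℕ} {E : Finset (Finset ℕ)} {x : ℕ → ℝ}
    (h : Admissible m s E x) (hanti : Antitone x) : 0 < x 0 := by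
  by_contra! h0
  have : ∑ i ∈ range s, x i = 0 :=
    sum_eq_zero fun i _ => le_antisymm ((hanti (Nat.zero_le i)).trans h0) (h.nonneg i)
  rw [h.sum_eq] at this
  exact one_ne_zero this

/-- If the weight of a decreasing optimum on `n + 1` vertices exceeds the Lagrangian of the
complete `3`-graph on `n` vertices, then the four smallest weights are not much smaller than
the largest. -/
theorem IsOptimal.lt_mul_of_lt_wt {m n : ℕ} {E : Finset (Finset ℕ)} {x : ℕ → ℝ} (hn : 4 ≤ n)
    (h : IsOptimal m (n + 1) E x) (hanti : Antitone x)
    (hlt : ((n : ℝ) - 1) * (n - 2) / (6 * n ^ 2) < wt E x) :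
    (2 * (n : ℝ) - 2) * x 0 ≤ (3 * n - 2) * x (n - 3) := by
  by_contra! hsmall
  have hn' : (4 : ℝ) ≤ n := by exact_mod_cast hn
  have ha := h.zero_pos hanti
  set a := x 0 with ha0
  have h3 := h.three_mul_wt_le (Nat.succ_pos n) ha
  have h4 := linkWt_mono h.nonneg h.subset 0
  have h5 := two_mul_linkWt_powersetCard (i := 0) (mem_range.2 (Nat.succ_pos n)) h.sum_eq
  rw [← ha0] at h5
  set p2 := ∑ k ∈ range (n + 1), x k ^ 2 with hp2
  have hB : ((n : ℝ) - 1) * (n - 2) / n ^ 2 < 1 - 2 * a + 2 * a ^ 2 - p2 := by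
    have : ((n : ℝ) - 1) * (n - 2) / (6 * n ^ 2) = ((n : ℝ) - 1) * (n - 2) / n ^ 2 / 6 := by
      field_simp
    linarith
  have ha1 : a ≤ 1 := h.sum_eq ▸ single_le_sum (fun j _ => h.nonneg j)
    (mem_range.2 (Nat.succ_pos n))
  -- Cauchy–Schwarz on the other `n` weights turns `hB` into `n - 2 < n(1 - a)^2`. With `a ≥
  -- 1/(n-1)` this would give `(n-1)^2 < n(n-2)`.
  have hup : a * (n - 1) < 1 := by
    by_contra! hge
    have hcs : (1 - a) ^ 2 ≤ n * (p2 - a ^ 2) := by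
      have h6 := sum_range_succ' x n
      have h7 := sum_range_succ' (fun k => x k ^ 2) n
      rw [h.sum_eq] at h6
      have h8 := sq_sum_le_card_mul_sum_sq (s := range n) (f := fun k => x (k + 1))
      rw [card_range] at h8
      have e1 : 1 - a = ∑ k ∈ range n, x (k + 1) := by linarith
      have e2 : p2 - a ^ 2 = ∑ k ∈ range n, x (k + 1) ^ 2 := by
        rw [hp2, ha0]; linarith
      rwa [e1, e2]
    rw [div_lt_iff₀ (by positivity)] at hB
    have h9 : (n : ℝ) * (n - 2) < n * n * (1 - a) ^ 2 := by nlinarith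
    have h10 : (n : ℝ) - 2 < n * (1 - a) ^ 2 := by nlinarith
    have h11 : ((n : ℝ) - 1) * (1 - a) ≤ n - 2 := by linarith
    have h12 : (((n : ℝ) - 1) * (1 - a)) ^ 2 ≤ (n - 2) ^ 2 :=
      pow_le_pow_left₀ (mul_nonneg (by linarith) (by linarith)) h11 2
    have h13 : ((n : ℝ) - 1) ^ 2 * (n - 2) < n * (n - 2) ^ 2 := by
      have := mul_lt_mul_of_pos_left h10 (show 0 < ((n : ℝ) - 1) ^ 2 by nlinarith)
      nlinarith
    nlinarith
  -- The negated claim reads `x (n - 3) < (1 - δ) a` for `δ = n/(3n-2)`, so each of the four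
  -- smallest weights is at least `δ a` below `a`.
  obtain ⟨δ, hδ⟩ : ∃ δ : ℝ, (3 * (n : ℝ) - 2) * δ = n :=
    ⟨n / (3 * n - 2), by field_simp [show 3 * (n : ℝ) - 2 ≠ 0 by linarith]⟩
  have hδ0 : 0 ≤ δ := by
    by_contra! hneg
    nlinarith
  have hgap : ∀ i, n - 3 ≤ i → δ * a ≤ a - x i := by
    intro i hi
    have h6 : x i ≤ x (n - 3) := hanti hi
    by_contra! h7
    have h8 := mul_lt_mul_of_pos_left h7 (show 0 < 3 * (n : ℝ) - 2 by linarith)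
    have h9 := mul_le_mul_of_nonneg_left h6 (show 0 ≤ 3 * (n : ℝ) - 2 by linarith)
    have h10 : (3 * (n : ℝ) - 2) * (δ * a) = n * a := by rw [← mul_assoc, hδ]
    linarith
  have hT : Ico (n - 3) (n + 1) ⊆ range (n + 1) := fun i hi => by
    simp only [mem_Ico, mem_range] at hi ⊢; omega
  have hTc : (Ico (n - 3) (n + 1)).card = 4 := by rw [Nat.card_Ico]; omega
  have hU : 4 * δ * a ≤ ((n : ℝ) + 1) * a - 1 := by
    have h6 : (Ico (n - 3) (n + 1)).card • (δ * a) ≤ ∑ i ∈ Ico (n - 3) (n + 1), (a - x i) :=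
      card_nsmul_le_sum _ _ _ fun i hi => hgap i (mem_Ico.1 hi).1
    have h7 : ∑ i ∈ Ico (n - 3) (n + 1), (a - x i) ≤ ∑ i ∈ range (n + 1), (a - x i) :=
      sum_le_sum_of_subset_of_nonneg hT fun i _ _ => sub_nonneg.2 (hanti (Nat.zero_le i))
    have h8 : ∑ i ∈ range (n + 1), (a - x i) = ((n : ℝ) + 1) * a - 1 := by
      rw [sum_sub_distrib, h.sum_eq, sum_const, card_range, nsmul_eq_mul]
      push_cast
      ring
    rw [hTc, nsmul_eq_mul] at h6
    push_cast at h6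
    linarith
  have hD : 4 * δ ^ 2 * a ^ 2 ≤ ((n : ℝ) + 1) * a ^ 2 - 2 * a + p2 := by
    have h6 : (Ico (n - 3) (n + 1)).card • (δ * a) ^ 2 ≤
        ∑ i ∈ Ico (n - 3) (n + 1), (a - x i) ^ 2 :=
      card_nsmul_le_sum _ _ _ fun i hi =>
        pow_le_pow_left₀ (mul_nonneg hδ0 ha.le) (hgap i (mem_Ico.1 hi).1) 2
    have h7 : ∑ i ∈ Ico (n - 3) (n + 1), (a - x i) ^ 2 ≤ ∑ i ∈ range (n + 1), (a - x i) ^ 2 :=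
      sum_le_sum_of_subset_of_nonneg hT fun i _ _ => sq_nonneg _
    have h8 : ∑ i ∈ range (n + 1), (a - x i) ^ 2 = ((n : ℝ) + 1) * a ^ 2 - 2 * a + p2 := by
      have : ∀ i ∈ range (n + 1), (a - x i) ^ 2 = a ^ 2 - 2 * a * x i + x i ^ 2 :=
        fun i _ => by ring
      rw [sum_congr rfl this, sum_add_distrib, sum_sub_distrib, ← mul_sum, h.sum_eq, sum_const,
        card_range, nsmul_eq_mul]
      push_cast
      ring
    rw [hTc, nsmul_eq_mul] at h6
    push_cast at h6
    nlinarith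
  have := one_additional_vertex_aux hn' ha hδ hU hup
  nlinarith

/-- On `n + 1` vertices, at least `3n/2 - 1` missing triples bring the Lagrangian down to that of
the complete `3`-graph on `n` vertices. -/
theorem IsOptimal.wt_le {m n : ℕ} {E : Finset (Finset ℕ)} {x : ℕ → ℝ} (hn : 4 ≤ n)
    (h : IsOptimal m (n + 1) E x) (hanti : Antitone x)
    (hm : (m : ℝ) ≤ ((n + 1).choose 3 : ℝ) - (3 * n / 2 - 1)) :
    wt E x ≤ ((n : ℝ) - 1) * (n - 2) / (6 * n ^ 2) := by
  by_contra! hlt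
  have hratio := h.lt_mul_of_lt_wt hn hanti hlt
  have hn' : (4 : ℝ) ≤ n := by exact_mod_cast hn
  obtain ⟨r, rfl⟩ : ∃ r, n = r + 3 := ⟨n - 3, by omega⟩
  rw [Nat.add_sub_cancel] at hratio
  set N : ℝ := ((r + 3 : ℕ) : ℝ) with hN
  set S := range (r + 3 + 1) with hS
  have hp : r + 2 ∈ S := mem_range.2 (by omega)
  have hq : r + 3 ∈ S := mem_range.2 (by omega)
  have hpq : r + 2 ≠ r + 3 := by omega
  set K := S.powersetCard 3 with hK
  set H := K \ E with hH
  have hHK : H ⊆ K := sdiff_subset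
  set a := x 0
  set u := x (r + 2) with hu
  set v := x (r + 3) with hv
  have hu0 : 0 ≤ u := h.nonneg _
  have hv0 : 0 ≤ v := h.nonneg _
  -- The left side is the weight of the complete 3-graph after `v` is moved onto vertex `r + 2`;
  -- only `r + 3` vertices then carry weight.
  have hKy : wt K x - u * v * (1 - u - v) ≤ (N - 1) * (N - 2) / (6 * N ^ 2) := by
    have hK' : Admissible K.card (r + 3 + 1) K x :=
      ⟨subset_rfl, le_rfl, h.nonneg, h.eq_zero, h.sum_eq⟩
    have hy := hK'.shift hpq (mem_range.1 hp) (mem_range.1 hq) hv0 le_rfl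
    have hyq : shift x (r + 2) (r + 3) v (r + 3) = 0 := by rw [shift_right, ← hv, sub_self]
    have h1 := wt_shift K x hpq v
    have h2 := two_mul_linkWt_powersetCard hp h.sum_eq
    have h3 := two_mul_linkWt_powersetCard hq h.sum_eq
    have h4 := pairWt_powersetCard hp hq hpq x
    rw [h.sum_eq] at h4
    have h5 : wt K x - u * v * (1 - u - v) = wt K (shift x (r + 2) (r + 3) v) := by
      rw [h1, h4]
      linear_combination (-v / 2) * (h2 - h3)
    rw [h5, ← wt_filter_notMem K hyq]
    refine (wt_mono hy.nonneg (filter_notMem_subset hy.subset)).trans ?_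
    refine wt_powersetCard_three_le hn (card_range _) (fun i _ => hy.nonneg i) ?_
    have := hy.sum_eq
    rwa [sum_range_succ, hyq, add_zero] at this
  set T := (S.erase (r + 2)).erase (r + 3) with hT
  have hTc : T.card = r + 2 := by
    rw [hT, card_erase_of_mem (mem_erase.2 ⟨hpq.symm, hq⟩), card_erase_of_mem hp, hS, card_range]
    omega
  set C := T.filter (fun i => {i, r + 2, r + 3} ∈ H) with hC
  set D := T.filter (fun i => {i, r + 2, r + 3} ∉ H) with hD
  have hpairH : pairWt H (r + 2) (r + 3) x = ∑ i ∈ C, x i := pairWt_eq_sum hHK hpq x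
  have hcardCD : (C.card : ℝ) + D.card = N - 1 := by
    have := card_filter_add_card_filter_not (s := T) (fun i => {i, r + 2, r + 3} ∈ H)
    rw [hTc] at this
    have h' : (C.card : ℝ) + D.card = ((r + 2 : ℕ) : ℝ) := by exact_mod_cast this
    rw [h', hN]; push_cast; ring
  have hsumCD : 1 - u - v = ∑ i ∈ C, x i + ∑ i ∈ D, x i := by
    rw [hC, hD, sum_filter_add_sum_filter_not]
    have h1 := add_sum_erase S x hp
    have h2 := add_sum_erase (S.erase (r + 2)) x (mem_erase.2 ⟨hpq.symm, hq⟩)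
    rw [h.sum_eq] at h1
    rw [hT, hu, hv]
    linarith
  have hsumD : ∑ i ∈ D, x i ≤ D.card * a := by
    have := sum_le_card_nsmul D x a fun i _ => hanti (Nat.zero_le i)
    rwa [nsmul_eq_mul] at this
  have hcardH : 3 * N / 2 - 1 ≤ (H.card : ℝ) := by
    have h1 : H.card + E.card = K.card := by
      rw [hH, card_sdiff_of_subset h.subset]
      exact Nat.sub_add_cancel (card_le_card h.subset)
    rw [hK, card_powersetCard, hS, card_range] at h1
    have h2 : (H.card : ℝ) + E.card = ((r + 3 + 1).choose 3 : ℕ) := by exact_mod_cast h1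
    have h3 : (E.card : ℝ) ≤ m := by exact_mod_cast h.card_le
    linarith
  set H₂ := H.filter (fun e => r + 2 ∈ e ∧ r + 3 ∈ e) with hH₂
  set H₁ := H.filter (fun e => ¬(r + 2 ∈ e ∧ r + 3 ∈ e)) with hH₁
  -- Evaluating at the all-ones weighting turns the pair weight into a count.
  have hcardH₂ : (H₂.card : ℝ) = C.card := by
    have := pairWt_eq_sum hHK hpq (fun _ => (1 : ℝ))
    simpa [pairWt, ← hH₂, ← hC] using this
  have hcardH₁ : (H₁.card : ℝ) + H₂.card = H.card := by
    have := card_filter_add_card_filter_not (s := H) (fun e => r + 2 ∈ e ∧ r + 3 ∈ e)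
    rw [add_comm] at this
    exact_mod_cast this
  have hwtH : wt H x = wt H₂ x + wt H₁ x := (sum_filter_add_sum_filter_not H _ _).symm
  have hwtH₂ : wt H₂ x = u * v * ∑ i ∈ C, x i := by
    rw [← hpairH, pairWt, mul_sum, wt]
    refine sum_congr rfl fun e he => ?_
    have he' := (mem_filter.1 he).2
    rw [← mul_prod_erase e x he'.1, ← mul_prod_erase _ x (mem_erase.2 ⟨hpq.symm, he'.2⟩),
      mul_assoc]
  -- A triple without both of the last two vertices has its middle element at most `r + 1`, hence
  -- its smallest at most `r`.
  have hwtH₁ : H₁.card * (u * v * x r) ≤ wt H₁ x := by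
    rw [← nsmul_eq_mul]
    refine card_nsmul_le_sum _ _ _ fun e he => ?_
    obtain ⟨heH, hnot⟩ := mem_filter.1 he
    obtain ⟨heS, hcard⟩ := mem_powersetCard.1 (hHK heH)
    obtain ⟨i, j, l, hij, hjl, rfl⟩ := exists_lt_lt_eq_of_card_eq_three hcard
    have hl : l < r + 4 := mem_range.1 (heS (by simp))
    have hj : j ≤ r + 1 := by
      by_contra! hj
      exact hnot ⟨by simp; omega, by simp; omega⟩
    rw [prod_insert (by simp; omega), prod_insert (by simp; omega), prod_singleton]
    have h1 : x r ≤ x i := hanti (by omega)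
    have h2 : u ≤ x j := hanti (by omega)
    have h3 : v ≤ x l := hanti (by omega)
    have h4 : u * v ≤ x j * x l := mul_le_mul h2 h3 hv0 (h.nonneg j)
    calc u * v * x r = x r * (u * v) := mul_comm _ _
      _ ≤ x i * (x j * x l) := mul_le_mul h1 h4 (mul_nonneg hu0 hv0) (h.nonneg i)
  have hEH := wt_sdiff_add h.subset x
  have huv : 0 ≤ u * v := mul_nonneg hu0 hv0
  have hxr : x r ≤ a := hanti (Nat.zero_le r)
  have hxr0 : 0 ≤ x r := h.nonneg r
  have hDN : (D.card : ℝ) ≤ N - 1 := by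
    have : (0 : ℝ) ≤ C.card := Nat.cast_nonneg _
    linarith
  -- Here `|H₁| ≥ |D| + N/2` and `|D| ≤ N - 1`, so it suffices that `(N - 1)(a - x r) ≤ (N/2) x r`,
  -- which is `hratio`.
  have hfin : (D.card : ℝ) * a ≤ H₁.card * x r := by
    have h1 : (D.card : ℝ) + N / 2 ≤ H₁.card := by linarith
    have h2 := mul_le_mul_of_nonneg_right h1 hxr0
    have h3 := mul_le_mul_of_nonneg_right hDN (sub_nonneg.2 hxr)
    linarith
  have h1 := mul_le_mul_of_nonneg_left hfin huv
  have h2 := mul_le_mul_of_nonneg_left hsumD huv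
  have h3 : u * v * (1 - u - v) = u * v * ∑ i ∈ C, x i + u * v * ∑ i ∈ D, x i := by
    rw [hsumCD]; ring
  linarith

end FewVertices
end RGraph

namespace RGraph
open Finset

/-! ### Removing superfluous vertices -/

section Descent

/-- Discarding the lightest element never lowers the average; repeat until `f` elements remain. -/
theorem exists_subset_card_eq_mul_sum_le {ι : Type*} [DecidableEq ι] (S : Finset ι) (w : ι → ℝ)
    {f : ℕ} (hf : f ≤ S.card) :
    ∃ T ⊆ S, T.card = f ∧ f * ∑ i ∈ S, w i ≤ S.card * ∑ i ∈ T, w i := by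
  obtain rfl | hpos := Nat.eq_zero_or_pos f
  · exact ⟨∅, empty_subset _, by simp⟩
  obtain ⟨n, hn⟩ := Nat.exists_eq_add_of_le hf
  induction n generalizing S with
  | zero => exact ⟨S, subset_rfl, by omega, by rw [hn]; simp⟩
  | succ n ih =>
    obtain ⟨z, hz, hmin⟩ := exists_min_image S w (card_pos.1 (by omega))
    have hc : (S.erase z).card = f + n := by rw [card_erase_of_mem hz]; omega
    obtain ⟨T, hTS, hT, hsum⟩ := ih (S.erase z) (by omega) hc
    refine ⟨T, hTS.trans (erase_subset _ _), hT, ?_⟩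
    have h1 : (S.erase z).card • w z ≤ ∑ i ∈ S.erase z, w i :=
      card_nsmul_le_sum _ _ _ fun i hi => hmin i (mem_of_mem_erase hi)
    rw [nsmul_eq_mul, hc] at h1
    rw [hc] at hsum
    rw [hn, ← add_sum_erase S w hz]
    push_cast at *
    have hf0 : (0 : ℝ) < f := by exact_mod_cast hpos
    have hn0 : (0 : ℝ) ≤ n := Nat.cast_nonneg n
    have hfn : (0 : ℝ) < f + n := by linarith
    refine le_of_mul_le_mul_left ?_ hfn
    have h2 := mul_le_mul_of_nonneg_left h1 hf0.le
    have h3 := mul_le_mul_of_nonneg_left hsum (show (0 : ℝ) ≤ f + n + 1 by linarith)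
    linarith

theorem linkWt_eq_add_pairWt {α : Type*} [DecidableEq α] (E : Finset (Finset α)) {p q : α}
    (hpq : p ≠ q) (x : α → ℝ) :
    linkWt E p x = linkWt (E.filter (q ∉ ·)) p x + x q * pairWt E p q x := by
  simp only [linkWt, pairWt, sum_filter, mul_sum]
  rw [← sum_add_distrib]
  refine sum_congr rfl fun e _ => ?_
  by_cases hp : p ∈ e <;> by_cases hq : q ∈ e
  · simp only [hp, hq, not_true, if_true, if_false, and_self, zero_add]
    exact (mul_prod_erase _ x (mem_erase.2 ⟨hpq.symm, hq⟩)).symm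
  all_goals simp [hp, hq]

theorem LeftCompressed.mem_of_mem {E : Finset (Finset ℕ)} (hE : LeftCompressed E) {i j l j' : ℕ}
    (h : {i, j, l} ∈ E) (hj : j' ≤ j) (hij : i ≠ j) (hjl : j ≠ l) (hij' : i ≠ j')
    (hjl' : j' ≠ l) : {i, j', l} ∈ E := by
  obtain rfl | hlt := hj.eq_or_lt
  · exact h
  have := hE _ h j' j hlt (by simp) (by simp; omega)
  convert this using 1
  ext a
  simp only [mem_insert, mem_singleton, mem_erase]
  omega

/-- If `i` lies in the link of the last two vertices, then all triples through `i` are present. -/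
theorem LeftCompressed.mem_of_last_mem {E : Finset (Finset ℕ)} (hE : LeftCompressed E) {i k : ℕ}
    (hik : i < k) (h : {i, k, k + 1} ∈ E) {e : Finset ℕ}
    (he : e ∈ (range (k + 2)).powersetCard 3) (hie : i ∈ e) : e ∈ E := by
  obtain ⟨heS, hcard⟩ := mem_powersetCard.1 he
  have h2 : (e.erase i).card = 2 := by rw [card_erase_of_mem hie, hcard]
  obtain ⟨r, t, hrt, hrte⟩ : ∃ r t, r < t ∧ e.erase i = {r, t} := by
    obtain ⟨r, t, hne, hrt⟩ := card_eq_two.1 h2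
    rcases hne.lt_or_gt with h | h
    · exact ⟨r, t, h, hrt⟩
    · exact ⟨t, r, h, by rw [hrt, pair_comm]⟩
  have hr : r ∈ e.erase i := hrte ▸ by simp
  have ht : t ∈ e.erase i := hrte ▸ by simp
  rw [mem_erase] at hr ht
  have ht' : t < k + 2 := mem_range.1 (heS ht.2)
  have h3 : {i, r, k + 1} ∈ E :=
    hE.mem_of_mem h (by omega) (by omega) (by omega) hr.1.symm (by omega)
  have h4 : {i, k + 1, r} ∈ E := by rwa [pair_comm] at h3
  have h5 : {i, t, r} ∈ E :=
    hE.mem_of_mem h4 (by omega) (by omega) (by omega) ht.1.symm (by omega)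
  rw [← insert_erase hie, hrte, pair_comm]
  exact h5

/-- Deleting a vertex of weight zero. -/
theorem Admissible.filter_notMem {m s : ℕ} {E : Finset (Finset ℕ)} {x : ℕ → ℝ}
    (h : Admissible m (s + 1) E x) (hx : x s = 0) :
    Admissible m s (E.filter (s ∉ ·)) x where
  subset := filter_notMem_subset h.subset
  card_le := (card_filter_le _ _).trans h.card_le
  nonneg := h.nonneg
  eq_zero i hi := by
    obtain rfl | hlt := hi.eq_or_lt
    · exact hx
    · exact h.eq_zero i hlt
  sum_eq := by
    have := h.sum_eq
    rwa [sum_range_succ, hx, add_zero] at this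

/-- Double counting of pairs `i ∈ e` with `i ∈ L` and `k + 1 ∈ e ∈ E`: each `i` lies in `k` such
triples, and each triple has only two places besides `k + 1`. -/
theorem two_mul_card_ge {E : Finset (Finset ℕ)} {k : ℕ}
    (hE : E ⊆ (range (k + 2)).powersetCard 3) (L : Finset ℕ) (hL : ∀ i ∈ L, i < k)
    (hfull : ∀ i ∈ L, ∀ e ∈ (range (k + 2)).powersetCard 3, i ∈ e → e ∈ E) :
    (L.card : ℝ) * k ≤ 2 * (E.filter (k + 1 ∈ ·)).card := by
  have hq : k + 1 ∈ range (k + 2) := mem_range.2 (by omega)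
  have h1 : ∀ i ∈ L, pairWt E (k + 1) i (fun _ => (1 : ℝ)) = k := by
    intro i hi
    have hik := hL i hi
    have hiS : i ∈ range (k + 2) := mem_range.2 (by omega)
    rw [pairWt_eq_sum hE (by omega), filter_true_of_mem]
    · rw [sum_const, card_erase_of_mem (mem_erase.2 ⟨by omega, hiS⟩), card_erase_of_mem hq,
        card_range]
      simp
    · intro j hj
      simp only [mem_erase] at hj
      exact hfull i hi _ (triple_mem_powersetCard hj.2.2 hq hiS hj.2.1 hj.1 (by omega)) (by simp)
  have h2 : ∑ i ∈ L, pairWt E (k + 1) i (fun _ => (1 : ℝ)) ≤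
      2 * (E.filter (k + 1 ∈ ·)).card := by
    have h3 : ∀ i ∈ L, pairWt E (k + 1) i (fun _ => (1 : ℝ)) =
        ∑ e ∈ E.filter (k + 1 ∈ ·), if i ∈ e then 1 else 0 := by
      intro i _
      rw [pairWt, ← filter_filter, sum_filter]
      simp
    rw [sum_congr rfl h3, sum_comm, mul_comm, ← nsmul_eq_mul]
    refine sum_le_card_nsmul _ _ _ fun e he => ?_
    obtain ⟨heE, hqe⟩ := mem_filter.1 he
    have h4 : L.filter (· ∈ e) ⊆ e.erase (k + 1) := fun i hi => by
      rw [mem_filter] at hi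
      exact mem_erase.2 ⟨by have := hL i hi.1; omega, hi.2⟩
    have h5 := card_le_card h4
    rw [card_erase_of_mem hqe, (mem_powersetCard.1 (hE heE)).2] at h5
    rw [← sum_filter, sum_const, nsmul_eq_mul, mul_one]
    exact_mod_cast h5
  rwa [sum_congr rfl h1, sum_const, nsmul_eq_mul] at h2

theorem sq_card_le_linkWt {F : Finset (Finset ℕ)} {S : Finset ℕ} (hF : F ⊆ S.powersetCard 3)
    {x : ℕ → ℝ} {v : ℝ} (hv : 0 ≤ v) (hx : ∀ i ∈ S, v ≤ x i) (p : ℕ) :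
    ((F.filter (p ∈ ·)).card : ℝ) * v ^ 2 ≤ linkWt F p x := by
  rw [← nsmul_eq_mul]
  refine card_nsmul_le_sum _ _ _ fun e he => ?_
  obtain ⟨heF, hpe⟩ := mem_filter.1 he
  obtain ⟨heS, hcard⟩ := mem_powersetCard.1 (hF heF)
  have h2 : (e.erase p).card = 2 := by rw [card_erase_of_mem hpe, hcard]
  rw [← h2, ← prod_const]
  exact prod_le_prod (fun _ _ => hv) fun i hi => hx i (heS (mem_of_mem_erase hi))

/-- A lower bound for the weight of a family of triples after the weight of the last vertex has
been moved to the last but one. -/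
theorem wt_shift_last_ge {F : Finset (Finset ℕ)} {k : ℕ} (hF : F ⊆ (range (k + 1)).powersetCard 3)
    {x : ℕ → ℝ} (hanti : Antitone x) (hx : ∀ i, 0 ≤ x i) :
    x (k + 1) * linkWt F k x + F.card * (x k * x (k + 1) ^ 2) ≤
      wt F (shift x k (k + 1) (x (k + 1))) := by
  set u := x k
  set v := x (k + 1)
  have hvu : v ≤ u := hanti (Nat.le_succ k)
  have hv : 0 ≤ v := hx _
  have hu : 0 ≤ u := hx _
  have h1 := sq_card_le_linkWt (x := x) hF hv
    (fun i hi => hanti (by have := mem_range.1 hi; omega)) k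
  -- Triples through `k` now carry the factor `u + v`; the others weigh at least `u^3 ≥ u v^2`. By
  -- `h1` the `u`-part of the former also yields `u v^2` per triple.
  have h2 : (u + v) * linkWt F k x + ((F.filter (k ∉ ·)).card : ℝ) * (u * v ^ 2) ≤
      wt F (shift x k (k + 1) v) := by
    rw [wt, ← sum_filter_add_sum_filter_not F (k ∈ ·), linkWt, mul_sum, ← nsmul_eq_mul]
    refine add_le_add (sum_le_sum fun e he => ?_) (card_nsmul_le_sum _ _ _ fun e he => ?_)
    · obtain ⟨heF, hke⟩ := mem_filter.1 he
      rw [← mul_prod_erase e _ hke, shift_left x (by omega)]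
      refine le_of_eq (congrArg _ (prod_congr rfl fun i hi => ?_))
      have hi' := mem_range.1 ((mem_powersetCard.1 (hF heF)).1 (mem_of_mem_erase hi))
      exact (shift_of_ne x (ne_of_mem_erase hi) (by omega) v).symm
    · obtain ⟨heF, hke⟩ := mem_filter.1 he
      obtain ⟨heS, hcard⟩ := mem_powersetCard.1 (hF heF)
      have h3 : ∏ _i ∈ e, u ≤ ∏ i ∈ e, shift x k (k + 1) v i := by
        refine prod_le_prod (fun _ _ => hu) fun i hi => ?_
        have hik : i ≠ k := ne_of_mem_of_not_mem hi hke
        have hi' := mem_range.1 (heS hi)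
        rw [shift_of_ne x hik (by omega)]
        exact hanti (by omega)
      rw [prod_const, hcard] at h3
      have h4 : v ^ 2 ≤ u ^ 2 := pow_le_pow_left₀ hv hvu 2
      calc u * v ^ 2 ≤ u * u ^ 2 := mul_le_mul_of_nonneg_left h4 hu
        _ = u ^ 3 := by ring
        _ ≤ _ := h3
  have h3 : ((F.filter (k ∈ ·)).card : ℝ) + (F.filter (k ∉ ·)).card = F.card := by
    exact_mod_cast card_filter_add_card_filter_not (s := F) (k ∈ ·)
  rw [← h3]
  have h4 := mul_le_mul_of_nonneg_left h1 hu
  linarith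

/-- With at most `(k + 1).choose 3` triples, the last of `k + 2` vertices is not needed. -/
theorem Admissible.exists_last_eq_zero {m k : ℕ} (hk : 4 ≤ k) (hm : m ≤ (k + 1).choose 3)
    {E₀ : Finset (Finset ℕ)} {x₀ : ℕ → ℝ} (h₀ : Admissible m (k + 2) E₀ x₀) :
    ∃ E x, Admissible m (k + 1) E x ∧ wt E₀ x₀ ≤ wt E x := by
  obtain ⟨E, x, h, hanti, hcomp⟩ := h₀.exists_isOptimal_leftCompressed
  set S := range (k + 2) with hS
  set K := S.powersetCard 3 with hK
  set a := x 0 with ha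
  set u := x k with hu
  set v := x (k + 1) with hv
  have hvu : v ≤ u := hanti (Nat.le_succ k)
  have hua : u ≤ a := hanti (Nat.zero_le k)
  obtain hv0 | hv0 := (h.nonneg (k + 1)).eq_or_lt
  · exact ⟨_, x, h.filter_notMem hv0.symm, by
      rw [wt_filter_notMem E hv0.symm]; exact h.le _ _ h₀⟩
  rw [← hv] at hv0
  have hu0 : 0 < u := hv0.trans_le hvu
  have ha0 : 0 < a := hu0.trans_le hua
  have hkq : k ≠ k + 1 := by omega
  have hpS : k ∈ S := mem_range.2 (by omega)
  have hqS : k + 1 ∈ S := mem_range.2 (by omega)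
  have h0S : 0 ∈ S := mem_range.2 (by omega)
  set y := RGraph.shift x k (k + 1) v with hy
  have hyadm : Admissible m (k + 2) E y := h.shift hkq (by omega) (by omega) hv0.le le_rfl
  have hyq : y (k + 1) = 0 := by rw [hy, shift_right, ← hv, sub_self]
  have hlink : linkWt E k x = linkWt E (k + 1) x :=
    le_antisymm (h.linkWt_le (by omega) (by omega) hv0) (h.linkWt_le (by omega) (by omega) hu0)
  have hwty : wt E y = wt E x - v ^ 2 * pairWt E k (k + 1) x := by
    rw [hy, wt_shift E x hkq, hlink]; ring
  set M := (range (k + 1)).powersetCard 3 \ E with hM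
  set f := (E.filter (k + 1 ∈ ·)).card with hf
  -- After the move, the `f` triples through `k + 1` weigh nothing and may be exchanged for up to
  -- `f` missing triples, which must recover the loss `v^2 * pairWt`.
  suffices hF : ∃ F ⊆ M, F.card ≤ f ∧ v ^ 2 * pairWt E k (k + 1) x ≤ wt F y by
    obtain ⟨F, hFM, hFf, hFwt⟩ := hF
    have h' := hyadm.filter_notMem hyq
    have hdisj : Disjoint (E.filter (k + 1 ∉ ·)) F := by
      refine disjoint_left.2 fun e he heF => ?_
      exact (mem_sdiff.1 (hFM heF)).2 (mem_filter.1 he).1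
    refine ⟨E.filter (k + 1 ∉ ·) ∪ F, y, ⟨union_subset h'.subset
      (hFM.trans sdiff_subset), ?_, h'.nonneg, h'.eq_zero, h'.sum_eq⟩, ?_⟩
    · refine (card_union_le _ _).trans (le_trans ?_ h.card_le)
      have := card_filter_add_card_filter_not (s := E) (k + 1 ∈ ·)
      omega
    · rw [wt_union hdisj, wt_filter_notMem E hyq, hwty]
      have := h.le _ _ h₀
      linarith
  set L := ((S.erase k).erase (k + 1)).filter (fun i => {i, k, k + 1} ∈ E) with hL
  have hpair : pairWt E k (k + 1) x = ∑ i ∈ L, x i := pairWt_eq_sum h.subset hkq x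
  have hLk : ∀ i ∈ L, i < k := fun i hi => by
    simp only [hL, mem_filter, mem_erase, hS, mem_range] at hi; omega
  have hLfull : ∀ i ∈ L, ∀ e ∈ K, i ∈ e → e ∈ E := fun i hi e he hie =>
    hcomp.mem_of_last_mem (hLk i hi) (mem_filter.1 hi).2 he hie
  obtain hL0 | ⟨l, hl⟩ := L.eq_empty_or_nonempty
  · refine ⟨∅, empty_subset _, by simp, ?_⟩
    rw [hpair, hL0]
    simp [wt]
  set b : ℝ := (L.card : ℝ) with hb
  have hb1 : 1 ≤ b := by
    rw [hb]; exact_mod_cast card_pos.2 ⟨l, hl⟩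
  have hk4 : (4 : ℝ) ≤ k := by exact_mod_cast hk
  have hbk : b ≤ k := by
    have : L ⊆ range k := fun i hi => mem_range.2 (hLk i hi)
    have := card_le_card this
    rw [card_range] at this
    rw [hb]; exact_mod_cast this
  have h0L : 0 ∈ L := by
    refine mem_filter.2 ⟨mem_erase.2 ⟨by omega, mem_erase.2 ⟨by omega, h0S⟩⟩, ?_⟩
    have h1 := (mem_filter.1 hl).2
    have hlk := hLk l hl
    by_cases hl0 : l = 0
    · rwa [hl0] at h1
    · have h2 := hcomp _ h1 0 l (by omega) (by simp) (by simp; omega)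
      rwa [erase_insert (by simp; omega)] at h2
  have hcount : b * k ≤ 2 * f := two_mul_card_ge h.subset L hLk hLfull
  have hpa : pairWt E k (k + 1) x ≤ b * a := by
    rw [hpair, hb, ← nsmul_eq_mul]
    exact sum_le_card_nsmul _ _ _ fun i _ => hanti (Nat.zero_le i)
  have hap : a ≤ pairWt E k (k + 1) x := by
    rw [hpair]
    exact single_le_sum (fun i _ => h.nonneg i) h0L
  set H := K \ E with hH
  set W := 1 - a - u with hW
  have hWv : k * v ≤ W := by
    have h1 := add_sum_erase S x h0S
    have h2 := add_sum_erase (S.erase 0) x (mem_erase.2 ⟨show k ≠ 0 by omega, hpS⟩)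
    have h3 : ((S.erase 0).erase k).card • v ≤ ∑ i ∈ (S.erase 0).erase k, x i := by
      refine card_nsmul_le_sum _ _ _ fun i hi => hanti ?_
      simp only [mem_erase, hS, mem_range] at hi
      omega
    rw [card_erase_of_mem (mem_erase.2 ⟨by omega, hpS⟩), card_erase_of_mem h0S, hS, card_range,
      nsmul_eq_mul, show k + 2 - 1 - 1 = k by omega, ← hS] at h3
    rw [h.sum_eq] at h1
    rw [hW, ha, hu]
    linarith
  have hHM : H.filter (k + 1 ∉ ·) = M := by
    ext e
    simp only [hH, hM, mem_filter, mem_sdiff]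
    constructor
    · rintro ⟨⟨h1, h2⟩, h3⟩
      exact ⟨filter_notMem_subset subset_rfl (mem_filter.2 ⟨h1, h3⟩), h2⟩
    · rintro ⟨h1, h2⟩
      refine ⟨⟨powersetCard_mono (range_subset_range.2 (by omega)) h1, h2⟩, fun h3 => ?_⟩
      have := (mem_powersetCard.1 h1).1 h3
      simp at this
  -- No missing triple contains `0`, and the link of `k` in `E` is no heavier than that of `0`.
  -- Hence the missing link of `k` is at least the difference `(a - u)W` of the complete links; its
  -- part through `k + 1` is at most `vW`.
  have hQ : (a - u - v) * W ≤ linkWt M k x := by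
    have h1 := linkWt_sdiff_add h.subset 0 x
    have h2 := linkWt_sdiff_add h.subset k x
    have h3 : linkWt (K \ E) 0 x = 0 := by
      rw [linkWt, filter_false_of_mem, sum_empty]
      intro e he h0
      exact (mem_sdiff.1 he).2 (hLfull 0 h0L e (mem_sdiff.1 he).1 h0)
    have h4 := h.linkWt_le (i := k) (by omega) (by omega) ha0
    have h5 := two_mul_linkWt_powersetCard h0S h.sum_eq
    have h6 := two_mul_linkWt_powersetCard hpS h.sum_eq
    have h7 := linkWt_eq_add_pairWt H hkq x
    rw [hHM] at h7
    have h8 := pairWt_sdiff_add h.subset k (k + 1) x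
    have h9 := pairWt_powersetCard hpS hqS hkq x
    rw [h.sum_eq] at h9
    rw [← hK] at h5 h6 h9
    rw [← hS, ← hK] at h1 h2 h8
    rw [← hH] at h2 h8
    have h10 : pairWt H k (k + 1) x ≤ W := by rw [hW]; linarith
    have h11 := mul_le_mul_of_nonneg_left h10 hv0.le
    have h12 : (a - u) * W ≤ linkWt H k x := by
      rw [hW]; linarith
    linarith
  have hMf : f ≤ M.card := by
    have h1 : (E.filter (k + 1 ∉ ·)).card + M.card ≥ (k + 1).choose 3 := by
      have h2 : (range (k + 1)).powersetCard 3 ⊆ E.filter (k + 1 ∉ ·) ∪ M := by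
        intro e he
        by_cases heE : e ∈ E
        · refine mem_union_left _ (mem_filter.2 ⟨heE, fun h3 => ?_⟩)
          have := (mem_powersetCard.1 he).1 h3
          simp at this
        · exact mem_union_right _ (mem_sdiff.2 ⟨he, heE⟩)
      have h3 := (card_le_card h2).trans (card_union_le _ _)
      rwa [card_powersetCard, card_range] at h3
    have h2 := card_filter_add_card_filter_not (s := E) (k + 1 ∈ ·)
    have h3 := h.card_le
    omega
  have hf0 : (0 : ℝ) < f := by nlinarith
  -- If `f` covers all missing triples through `k`, take them all and use `b ≤ k`. Otherwise take
  -- the `f` heaviest of these at most `k(k-1)/2` triples; `f ≥ bk/2` makes them at least a fraction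
  -- `b/k` of the whole.
  have hsel : ∃ F ⊆ M, F.card = f ∧ b * linkWt M k x ≤ k * linkWt F k x := by
    have hnn := linkWt_nonneg h.nonneg (E := M) k
    obtain hle | hle := le_total (M.filter (k ∈ ·)).card f
    · obtain ⟨F, hF₁, hF₂, hFc⟩ := exists_subsuperset_card_eq (filter_subset _ M) hle hMf
      refine ⟨F, hF₂, hFc, ?_⟩
      have hFM : F.filter (k ∈ ·) = M.filter (k ∈ ·) := by
        ext e
        simp only [mem_filter]
        exact ⟨fun he => ⟨hF₂ he.1, he.2⟩, fun he => ⟨hF₁ (mem_filter.2 he), he.2⟩⟩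
      rw [linkWt, linkWt, hFM, ← linkWt]
      exact mul_le_mul_of_nonneg_right hbk hnn
    · obtain ⟨F, hF, hFc, hsum⟩ := exists_subset_card_eq_mul_sum_le (M.filter (k ∈ ·))
        (fun e => ∏ i ∈ e.erase k, x i) hle
      refine ⟨F, hF.trans (filter_subset _ _), hFc, ?_⟩
      have hFF : F.filter (k ∈ ·) = F := filter_true_of_mem fun e he => (mem_filter.1 (hF he)).2
      have hsum' : f * linkWt M k x ≤ (M.filter (k ∈ ·)).card * linkWt F k x := by
        rwa [linkWt, linkWt, hFF]
      have hFnn := linkWt_nonneg h.nonneg (E := F) k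
      have hcard : ((M.filter (k ∈ ·)).card : ℝ) ≤ k * (k - 1) / 2 := by
        have h1 : M.filter (k ∈ ·) ⊆
            (((range (k + 1)).erase k).powersetCard 2).image (insert k) := by
          rw [← filter_mem_powersetCard_succ (mem_range.2 (Nat.lt_succ_self k))]
          exact filter_subset_filter _ sdiff_subset
        have h2 := (card_le_card h1).trans card_image_le
        rw [card_powersetCard, card_erase_of_mem (mem_range.2 (Nat.lt_succ_self k)), card_range,
          Nat.succ_sub_one] at h2
        rw [← Nat.cast_choose_two]
        exact_mod_cast h2
      refine le_of_mul_le_mul_left ?_ hf0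
      calc f * (b * linkWt M k x) = b * (f * linkWt M k x) := by ring
        _ ≤ b * ((M.filter (k ∈ ·)).card * linkWt F k x) :=
          mul_le_mul_of_nonneg_left hsum' (by linarith)
        _ = b * (M.filter (k ∈ ·)).card * linkWt F k x := by ring
        _ ≤ f * k * linkWt F k x := by
          refine mul_le_mul_of_nonneg_right ?_ hFnn
          have h3 := mul_le_mul_of_nonneg_left hcard (show 0 ≤ b by linarith)
          have h4 := mul_le_mul_of_nonneg_right hcount (show (0 : ℝ) ≤ k - 1 by linarith)
          nlinarith
        _ = f * (k * linkWt F k x) := by ring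
  obtain ⟨F, hFM, hFc, hFsel⟩ := hsel
  refine ⟨F, hFM, hFc.le, ?_⟩
  have hFy := wt_shift_last_ge (hFM.trans sdiff_subset) hanti h.nonneg
  rw [hFc, ← hu, ← hv, ← hy] at hFy
  have hQF := linkWt_nonneg h.nonneg (E := F) k
  have hW0 : 0 < W := by nlinarith
  have hkey : v * b * (a - u - v) ≤ linkWt F k x := by
    refine le_of_mul_le_mul_left ?_ hW0
    have h1 := mul_le_mul_of_nonneg_left hQ (show 0 ≤ v * b by nlinarith)
    have h2 := mul_le_mul_of_nonneg_left hFsel hv0.le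
    have h3 := mul_le_mul_of_nonneg_right hWv hQF
    linarith
  -- `f ≥ bk/2 ≥ 2b`, which uses `k ≥ 4`.
  have hfb : b * (u + v) ≤ f * u := by
    have h1 : 2 * b ≤ f := by nlinarith
    have h2 := mul_le_mul_of_nonneg_right h1 hu0.le
    have h3 := mul_le_mul_of_nonneg_left hvu (show 0 ≤ b by linarith)
    linarith
  calc v ^ 2 * pairWt E k (k + 1) x ≤ v ^ 2 * (b * a) :=
        mul_le_mul_of_nonneg_left hpa (sq_nonneg v)
    _ = v * (v * b * (a - u - v)) + b * (u + v) * v ^ 2 := by ring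
    _ ≤ v * linkWt F k x + f * u * v ^ 2 :=
        add_le_add (mul_le_mul_of_nonneg_left hkey hv0.le)
          (mul_le_mul_of_nonneg_right hfb (sq_nonneg v))
    _ = v * linkWt F k x + f * (u * v ^ 2) := by ring
    _ ≤ wt F y := hFy

end Descent
end RGraph

namespace RGraph
open Finset

/-! ### The value of the Lagrangian -/

section Main

theorem Admissible.exists_of_le {m n : ℕ} (hn : 4 ≤ n) (hm : m ≤ (n + 1).choose 3) (d : ℕ) :
    ∀ {E : Finset (Finset ℕ)} {x : ℕ → ℝ}, Admissible m (n + 1 + d) E x →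
      ∃ E' x', Admissible m (n + 1) E' x' ∧ wt E x ≤ wt E' x' := by
  induction d with
  | zero => exact fun h => ⟨_, _, h, le_rfl⟩
  | succ d ih =>
    intro E x h
    have hm' : m ≤ (n + d + 1).choose 3 := hm.trans (Nat.choose_le_choose 3 (by omega))
    have h' : Admissible m (n + d + 2) E x := by
      rwa [show n + d + 2 = n + 1 + (d + 1) by omega]
    obtain ⟨E₁, x₁, h₁, hle₁⟩ := h'.exists_last_eq_zero (by omega) hm'
    rw [show n + d + 1 = n + 1 + d by omega] at h₁
    obtain ⟨E₂, x₂, h₂, hle₂⟩ := ih h₁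
    exact ⟨E₂, x₂, h₂, hle₁.trans hle₂⟩

/-- A `3`-graph with at least `3n/2 - 1` edges fewer than the complete `3`-graph on `n + 1`
vertices has Lagrangian at most that of the complete `3`-graph on `n` vertices. -/
theorem lagrangian_le_of_card_le {α : Type*} (G : RGraph 3 α) {n : ℕ} (hn : 4 ≤ n)
    (hm : (G.edges.card : ℝ) ≤ ((n + 1).choose 3 : ℝ) - (3 * n / 2 - 1)) :
    G.lagrangian ≤ ((n : ℝ) - 1) * (n - 2) / (6 * n ^ 2) := by
  classical
  have hn' : (4 : ℝ) ≤ n := by exact_mod_cast hn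
  -- Nonnegativity of the bound is needed for a graph without vertices, where the supremum is `sSup
  -- ∅ = 0`.
  refine Real.sSup_le ?_ (by
    have h1 : (0 : ℝ) ≤ n - 1 := by linarith
    have h2 : (0 : ℝ) ≤ n - 2 := by linarith
    positivity)
  rintro _ ⟨x, ⟨hx, hsum⟩, rfl⟩
  obtain ⟨E₁, x₁, h₁, -, hwt⟩ := exists_admissible_antitone G.edges_subset le_rfl hx hsum
  have hle : G.edges.card ≤ (n + 1).choose 3 := by
    have : (G.edges.card : ℝ) ≤ ((n + 1).choose 3 : ℝ) := by linarith
    exact_mod_cast this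
  obtain ⟨E₂, x₂, h₂, hle₂⟩ := Admissible.exists_of_le hn hle G.verts.card
    (h₁.mono (show G.verts.card ≤ n + 1 + G.verts.card by omega))
  obtain ⟨E₃, x₃, h₃, hanti, -⟩ := h₂.exists_isOptimal_leftCompressed
  calc G.lagrangianPoly x = wt E₁ x₁ := hwt.symm
    _ ≤ wt E₂ x₂ := hle₂
    _ ≤ wt E₃ x₃ := h₃.le _ _ h₂
    _ ≤ _ := h₃.wt_le hn hanti hm

/-- Uniform weights `1/n` on `[n]` attain the bound. They are feasible since `n ≥ 3` puts every
vertex of `[n]` in an edge of `G`. -/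
theorem le_lagrangian_of_complete_subset {G : RGraph 3 ℕ} {n : ℕ} (hn : 3 ≤ n)
    (h : (complete 3 n).edges ⊆ G.edges) :
    ((n : ℝ) - 1) * (n - 2) / (6 * n ^ 2) ≤ G.lagrangian := by
  have hn' : (3 : ℝ) ≤ n := by exact_mod_cast hn
  have hV : Icc 1 n ⊆ G.verts := by
    intro i hi
    obtain ⟨T, hiT, hT, hTc⟩ := exists_subsuperset_card_eq (n := 3) (singleton_subset_iff.2 hi) (by simp)
      (by simpa using hn)
    exact (mem_powersetCard.1 (G.edges_subset (h (mem_powersetCard.2 ⟨hT, hTc⟩)))).1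
      (hiT (mem_singleton_self i))
  set x : ℕ → ℝ := fun i => if i ∈ Icc 1 n then 1 / (n : ℝ) else 0 with hx
  have hx0 : ∀ i, 0 ≤ x i := fun i => by simp only [hx]; split_ifs <;> positivity
  have hsumx : ∀ i ∈ Icc 1 n, x i = 1 / (n : ℝ) := fun i hi => by simp [hx, mem_Icc.1 hi]
  have hfeas : G.IsFeasible x := by
    refine ⟨fun i _ => hx0 i, ?_⟩
    rw [← sum_subset hV fun i _ hi => by simp only [hx, hi, if_false], sum_congr rfl hsumx]
    simp
    field_simp
  have hle : G.lagrangianPoly x ≤ G.lagrangian :=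
    (G.isGreatest_lagrangian ⟨1, hV (mem_Icc.2 ⟨le_rfl, by omega⟩)⟩).2 ⟨x, hfeas, rfl⟩
  refine le_trans ?_ hle
  refine le_trans ?_ (wt_mono hx0 h : wt _ x ≤ wt _ x)
  have h6 := six_mul_wt_powersetCard_three (Icc 1 n) x
  rw [sum_congr rfl hsumx,
    sum_congr rfl (fun i hi => by rw [hsumx i hi] : ∀ i ∈ Icc 1 n, x i ^ 2 = (1 / (n : ℝ)) ^ 2),
    sum_congr rfl (fun i hi => by rw [hsumx i hi] : ∀ i ∈ Icc 1 n, x i ^ 3 = (1 / (n : ℝ)) ^ 3)]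
    at h6
  simp only [sum_const, Nat.card_Icc, nsmul_eq_mul, Nat.add_sub_cancel] at h6
  have e : 6 * (((n : ℝ) - 1) * (n - 2) / (6 * n ^ 2)) = (n * (1 / (n : ℝ))) ^ 3 -
      3 * (n * (1 / n)) * (n * (1 / n) ^ 2) + 2 * (n * (1 / n) ^ 3) := by
    field_simp
    ring
  rw [← e] at h6
  exact le_of_eq (mul_left_cancel₀ (by norm_num) h6.symm)

/-! ### Initial segments of the colex ordering -/

theorem subset_Icc_of_toColex_lt {A B : Finset ℕ} {r n : ℕ} (hA : A ⊆ Icc 1 n)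
    (hB : B ∈ posSubsets r) (h : toColex B < toColex A) : B ∈ (Icc 1 n).powersetCard r := by
  refine mem_powersetCard.2 ⟨fun b hb => ?_, hB.1⟩
  have := Colex.forall_lt_mono h.le (a := n + 1)
    (fun a ha => by have := mem_Icc.1 (hA ha); omega) b hb
  exact mem_Icc.2 ⟨hB.2 b hb, by omega⟩

theorem finite_predecessors (r : ℕ) (A : Finset ℕ) :
    {B | B ∈ posSubsets r ∧ toColex B < toColex A}.Finite := by
  refine ((range (A.sup id + 1)).powerset.finite_toSet).subset fun B hB => ?_
  rw [mem_coe, mem_powerset]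
  intro b hb
  exact mem_range.2 (Colex.forall_lt_mono hB.2.le
    (fun a ha => Nat.lt_succ_of_le (le_sup (f := id) ha)) b hb)

theorem infinite_posSubsets {r : ℕ} (hr : 0 < r) : (posSubsets r).Infinite := by
  refine Set.infinite_of_injective_forall_mem (f := fun k : ℕ => Ico (k + 1) (k + 1 + r))
    (fun k l h => ?_) fun k => ⟨by simp, fun a ha => ?_⟩
  · have h1 : k + 1 ∈ Ico (l + 1) (l + 1 + r) := by
      rw [← show Ico (k + 1) (k + 1 + r) = Ico (l + 1) (l + 1 + r) from h]; simp; omega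
    have h2 : l + 1 ∈ Ico (k + 1) (k + 1 + r) := by
      rw [show Ico (k + 1) (k + 1 + r) = Ico (l + 1) (l + 1 + r) from h]; simp; omega
    simp only [mem_Ico] at h1 h2
    omega
  · have := (mem_Ico.1 ha).1
    omega

/-- The colex-least set outside the first `m` has exactly those `m` sets as predecessors, so it is
the one set added at `m + 1`. It exists because there are infinitely many `r`-sets, each with
finitely many predecessors; this fails for `r = 0`. -/
theorem ncard_colexFirst {r : ℕ} (hr : 0 < r) (m : ℕ) : (colexFirst r m).ncard = m := by
  induction m with
  | zero => simp [colexFirst]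
  | succ m ih =>
    have hmono : ∀ A B, A ∈ posSubsets r → toColex A < toColex B →
        {C | C ∈ posSubsets r ∧ toColex C < toColex A}.encard <
          {C | C ∈ posSubsets r ∧ toColex C < toColex B}.encard := by
      intro A B hA hAB
      refine (finite_predecessors r A).encard_lt_encard ⟨fun C hC => ⟨hC.1, hC.2.trans hAB⟩, ?_⟩
      exact fun h => lt_irrefl _ (h (show A ∈ _ from ⟨hA, hAB⟩)).2
    obtain ⟨B, hB, hBm⟩ : ∃ B ∈ posSubsets r, B ∉ colexFirst r m := by
      by_contra! h
      exact infinite_posSubsets hr ((finite_colexFirst r m).subset h)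
    obtain ⟨A, ⟨⟨hA, hAm⟩, -⟩, hmin⟩ := Set.exists_min_image
      {C | (C ∈ posSubsets r ∧ C ∉ colexFirst r m) ∧ toColex C ≤ toColex B}
      (fun C => toColex C)
      (((finite_predecessors r B).insert B).subset fun C hC => by
        rcases hC.2.eq_or_lt with h | h
        · exact Or.inl (by simpa using h)
        · exact Or.inr ⟨hC.1.1, h⟩) ⟨B, ⟨hB, hBm⟩, le_rfl⟩
    have hAB : toColex A ≤ toColex B := hmin B ⟨⟨hB, hBm⟩, le_rfl⟩
    have hpre : {C | C ∈ posSubsets r ∧ toColex C < toColex A} = colexFirst r m := by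
      ext C
      constructor
      · rintro ⟨hC, hCA⟩
        by_contra hCm
        exact (hmin C ⟨⟨hC, hCm⟩, hCA.le.trans hAB⟩).not_gt hCA
      · rintro ⟨hC, hCm⟩
        refine ⟨hC, ?_⟩
        by_contra! hAC
        rcases hAC.eq_or_lt with h | h
        · have h' : A = C := by simpa using h
          exact hAm (h' ▸ ⟨hC, hCm⟩)
        · exact hAm ⟨hA, (hmono A C hA h).trans hCm⟩
    have hrank : {C | C ∈ posSubsets r ∧ toColex C < toColex A}.encard = m := by
      rw [hpre, ← (finite_colexFirst r m).cast_ncard_eq, ih]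
    have hsucc : colexFirst r (m + 1) = insert A (colexFirst r m) := by
      ext C
      constructor
      · rintro ⟨hC, hCm⟩
        by_contra hnot
        rw [Set.mem_insert_iff, not_or] at hnot
        rcases lt_trichotomy (toColex C) (toColex A) with h | h | h
        · exact hnot.2 (hpre ▸ ⟨hC, h⟩)
        · exact hnot.1 (by simpa using h)
        · have h1 := hmono A C hA h
          rw [hrank] at h1
          have h2 := Order.add_one_le_of_lt h1
          exact absurd hCm (not_lt.2 (by exact_mod_cast h2))
      · rintro (rfl | ⟨hC, hCm⟩)
        · exact ⟨hA, by rw [hrank]; exact_mod_cast Nat.lt_succ_self m⟩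
        · exact ⟨hC, hCm.trans (by exact_mod_cast Nat.lt_succ_self m)⟩
    rw [hsucc, Set.ncard_insert_of_notMem hAm (finite_colexFirst r m), ih]

theorem card_edges_colexGraph {r : ℕ} (hr : 0 < r) (m : ℕ) :
    (colexGraph r m).edges.card = m := by
  have h := ncard_colexFirst hr m
  rwa [Set.ncard_eq_toFinset_card _ (finite_colexFirst r m)] at h

/-- Colex predecessors of a subset of `[n]` stay inside `[n]`, so there are fewer than `n.choose r`
of them. -/
theorem complete_subset_colexGraph {r m n : ℕ} (h : n.choose r ≤ m) :
    (complete r n).edges ⊆ (colexGraph r m).edges := by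
  intro A (hA : A ∈ (Icc 1 n).powersetCard r)
  refine (finite_colexFirst r m).mem_toFinset.2 ?_
  obtain ⟨hAn, hAc⟩ := mem_powersetCard.1 hA
  refine ⟨⟨hAc, fun a ha => (mem_Icc.1 (hAn ha)).1⟩, ?_⟩
  have hsub : {B | B ∈ posSubsets r ∧ toColex B < toColex A} ⊆
      (((Icc 1 n).powersetCard r).erase A : Finset (Finset ℕ)) := by
    rintro B ⟨hB, hBA⟩
    rw [mem_coe, mem_erase]
    exact ⟨fun h => hBA.ne (congrArg toColex h), subset_Icc_of_toColex_lt hAn hB hBA⟩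
  refine (Set.encard_le_encard hsub).trans_lt ?_
  rw [Set.encard_coe_eq_coe_finsetCard]
  have hpos := card_pos.2 ⟨A, hA⟩
  have hc : ((Icc 1 n).powersetCard r).card = n.choose r := by simp
  have : (((Icc 1 n).powersetCard r).erase A).card < m := by
    rw [card_erase_of_mem hA]
    omega
  exact_mod_cast this

theorem lagrangian_nonneg {r : ℕ} {α : Type*} (G : RGraph r α) : 0 ≤ G.lagrangian := by
  refine Real.sSup_nonneg ?_
  rintro _ ⟨x, hx, rfl⟩
  exact sum_nonneg fun e he => prod_nonneg fun i hi =>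
    hx.1 i ((mem_powersetCard.1 (G.edges_subset he)).1 hi)

theorem lagrangian_le_zero {r : ℕ} {α : Type*} (G : RGraph r α) (h : G.edges.card = 0) :
    G.lagrangian ≤ 0 := by
  refine Real.sSup_le ?_ le_rfl
  rintro _ ⟨x, _, rfl⟩
  rw [lagrangianPoly, card_eq_zero.1 h, sum_empty]

theorem card_edges_complete (r s : ℕ) : (complete r s).edges.card = s.choose r := by
  simp [complete]

end Main
end RGraph

theorem mainTheorem2 (m t : ℕ)
    (hlow : (t - 1).choose 3 ≤ m)
    (hupp : (m : ℝ) ≤ ((t - 1).choose 3 : ℝ) + ((t - 2).choose 2 : ℝ) - ((t : ℝ) - 1) / 2) :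
    ((RGraph.colexGraph 3 m).edges.card = m ∧
      ∀ (α : Type*) (G : RGraph 3 α), G.edges.card = m →
        G.lagrangian ≤ (RGraph.colexGraph 3 m).lagrangian) ∧
    ∀ s : ℕ, s.choose 3 = m →
      (RGraph.complete 3 s).edges.card = m ∧
      ∀ (α : Type*) (G : RGraph 3 α), G.edges.card = m →
        G.lagrangian ≤ (RGraph.complete 3 s).lagrangian := by
  refine ⟨⟨RGraph.card_edges_colexGraph (by norm_num) m, ?_⟩,
    fun s hs => ⟨by rw [RGraph.card_edges_complete, hs], ?_⟩⟩
  all_goals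
    intro α G hG
    obtain rfl | hm0 := Nat.eq_zero_or_pos m
    · exact (G.lagrangian_le_zero hG).trans (RGraph.lagrangian_nonneg _)
    -- For `t ≤ 4`, truncated subtraction included, the upper bound is at most `1/2`.
    have ht : 5 ≤ t := by
      by_contra! ht
      have hm1 : (1 : ℝ) ≤ m := by exact_mod_cast hm0
      interval_cases t <;> norm_num [Nat.choose] at hupp <;> linarith
    obtain ⟨n, rfl⟩ : ∃ n, t = n + 1 := ⟨t - 1, by omega⟩
    obtain ⟨k, rfl⟩ : ∃ k, n = k + 1 := ⟨n - 1, by omega⟩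
    rw [Nat.add_sub_cancel] at hlow hupp
    rw [show k + 1 + 1 - 2 = k by omega] at hupp
    have hchoose : ((k + 1 + 1).choose 3 : ℝ) = ((k + 1).choose 3 : ℝ) + k.choose 2 + k := by
      have h1 : (k + 1 + 1).choose 3 = (k + 1).choose 2 + (k + 1).choose 3 :=
        Nat.choose_succ_succ _ _
      have h2 : (k + 1).choose 2 = k.choose 1 + k.choose 2 := Nat.choose_succ_succ _ _
      rw [h1, h2, Nat.choose_one_right]
      push_cast
      ring
    have hm : (m : ℝ) ≤ ((k + 1 + 1).choose 3 : ℝ) - (3 * (k + 1 : ℕ) / 2 - 1) := by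
      rw [hchoose]
      push_cast at hupp ⊢
      linarith
    refine (G.lagrangian_le_of_card_le (n := k + 1) (by omega) (by rwa [hG])).trans
      (RGraph.le_lagrangian_of_complete_subset (by omega) ?_)
  · exact RGraph.complete_subset_colexGraph hlow
  · refine Finset.powersetCard_mono (Finset.Icc_subset_Icc_right ?_)
    -- `s ≤ k` would give `s.choose 3 ≤ k.choose 3 < (k + 1).choose 3 ≤ m`.
    by_contra! hsk
    have h1 : s.choose 3 ≤ k.choose 3 := Nat.choose_le_choose 3 (by omega)
    have h2 : (k + 1).choose 3 = k.choose 2 + k.choose 3 := Nat.choose_succ_succ _ _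
    have h3 : 0 < k.choose 2 := Nat.choose_pos (by omega)
    omega
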